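/- For graphs $B$ (the board, finite or infinite) and $H$ (the target), the strong Ramsey game $\mathcal{R}(B,H)$ is played as follows. Two players, P1 and P2, alternately claim previously unclaimed edges of $B$, starting with P1. The first player whose claimed edges contain an isomorphic copy of $H$ wins; if neither player achieves this after finitely many moves, the game is a draw. The game $\mathcal{R}(B,H)$ is called a P1-win if P1 has a winning strategy. Let $K_\omega$ denote the countably infinite complete graph and $K_\omega\sqcup K_\omega$ the disjoint union of two copies of it. Corollary. The following two statements cannot both hold: (1) for every finite graph $H$, the game $\mathcal{R}(K_\omega,H)$ is a P1-win; (2) for every finite graph $H$, if $\mathcal{R}(K_\omega,H)$ is a P1-win, then $\mathcal{R}(K_\omega\sqcup K_\omega,H)$ is also a P1-win. -/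

import Mathlib

namespace RamseyGame

variable {V W : Type*}

/-- A complete play of the strong Ramsey game on the board `B`. The moves are numbered `0, 1, 2, …`;
the first player makes the even-numbered moves and the second player the odd-numbered ones.
`p n = some e` means that the edge `e` is claimed in move `n`, and `p n = none` means that no edge
of the board was left for move `n`. Every move claims a previously unclaimed edge of the board, and
the players go on as long as there is one. (Moves made after one of the players has won are
irrelevant to the outcome, see `FirstPlayerWins`.) -/
structure IsPlay (B : SimpleGraph V) (p : ℕ → Option (Sym2 V)) : Prop where
  mem_board : ∀ n e, p n = some e → e ∈ B.edgeSet
  unclaimed : ∀ n e, p n = some e → ∀ m < n, p m ≠ some e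
  exhausted : ∀ n, p n = none → ∀ e ∈ B.edgeSet, ∃ m < n, p m = some e

/-- The list of the edges claimed by the two players in the moves `0, …, n - 1`, in this order. -/
def history (p : ℕ → Option (Sym2 V)) (n : ℕ) : List (Sym2 V) :=
  (List.range n).filterMap p

/-- The graph (on the vertex set of the board) of all edges which the player who makes move `n`
has claimed up to and including move `n`. -/
def moverGraph (p : ℕ → Option (Sym2 V)) (n : ℕ) : SimpleGraph V :=
  SimpleGraph.fromEdgeSet {e | ∃ i ≤ n, i % 2 = n % 2 ∧ p i = some e}

/-- In move `n` an edge is claimed, and afterwards the player who claimed it owns all edges of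
an isomorphic copy of the target graph `H`. -/
def HasCopyAfter (H : SimpleGraph W) (p : ℕ → Option (Sym2 V)) (n : ℕ) : Prop :=
  p n ≠ none ∧ H.IsContained (moverGraph p n)

/-- The first player wins the play `p`: after finitely many moves some player owns a copy of `H`,
and the first move after which this happens is a move of the first player. -/
def FirstPlayerWins (H : SimpleGraph W) (p : ℕ → Option (Sym2 V)) : Prop :=
  ∃ n, Even n ∧ HasCopyAfter H p n ∧ ∀ m < n, ¬ HasCopyAfter H p m

/-- A strategy: it assigns to each list of the edges claimed so far an edge to be claimed next,
which is a previously unclaimed edge of the board whenever there is one. -/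
def IsStrategy (B : SimpleGraph V) (σ : List (Sym2 V) → Sym2 V) : Prop :=
  ∀ h : List (Sym2 V), (∃ e ∈ B.edgeSet, e ∉ h) → σ h ∈ B.edgeSet ∧ σ h ∉ h

/-- In the play `p` the first player makes all his moves according to `σ`. -/
def FirstPlayerFollows (σ : List (Sym2 V) → Sym2 V) (p : ℕ → Option (Sym2 V)) : Prop :=
  ∀ n, Even n → ∀ e, p n = some e → e = σ (history p n)

/-- The strong Ramsey game on the board `B` with target graph `H` is a first player win: the first
player has a strategy such that he wins every play in which he follows it. -/
def IsFirstPlayerWin (B : SimpleGraph V) (H : SimpleGraph W) : Prop :=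
  ∃ σ : List (Sym2 V) → Sym2 V, IsStrategy B σ ∧
    ∀ p, IsPlay B p → FirstPlayerFollows σ p → FirstPlayerWins H p

/-- The countably infinite complete graph. -/
abbrev Komega : SimpleGraph ℕ := ⊤

/-- The disjoint union of two countably infinite complete graphs. -/
abbrev twoKomega : SimpleGraph (ℕ ⊕ ℕ) := SimpleGraph.sum Komega Komega

end RamseyGame

/-! The witness is the book with four pages: an edge, the spine, both ends of which are joined to
four further vertices, the pages. On two infinite complete graphs the second player (red) can avoid
losing to the first (blue), see `not_isFirstPlayerWin_bookGraph`. So (1) would make this book a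
P1-win on one board, and (2) would carry that win to two boards, a contradiction.

Red replies to blue's first move in the other component, so blue has spent one edge elsewhere. The
draw comes from perpetual threats. If red has three pages on the spine `z s`, he plays `s y` with
`y` fresh and threatens `z y`. Blue must take `z y`, which gains him nothing, and red repeats this
forever (`Threat.surv`). It works as long as blue has no threat of his own. Should blue build one in
the other component, red blocks it and then pairs `p y` with `q y`, where `p q` is the spine of
blue's book; any move outside the pairing leaves blue without a threat and lets red start his own
(`core_surv`).

With only two red pages on `z s` the same device is used one level lower: `s y` threatens to make a
third page (`HalfPage.surv`). This needs blue to be harmless near `z`, which `Safe` and `Few`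
express. The opening (`surv_empty`) is a case analysis that reaches two pages with one end of the
spine safe; there everything is decided by counting blue edges. -/

namespace RamseyGame

/-! ### The board and its two components. -/

/-- The vertices of the board consisting of two infinite complete graphs. -/
def Vtx : Type := ℕ ⊕ ℕ

instance : DecidableEq Vtx := inferInstanceAs (DecidableEq (ℕ ⊕ ℕ))

/-- The component of the board in which a vertex lies. -/
def Vtx.side (v : Vtx) : Bool := Sum.isLeft v

/-- Finite sets of pairs of vertices. -/
abbrev Edges := Finset (Sym2 Vtx)

/-- The pair with the end vertices `a` and `b`. -/
def edge (a b : Vtx) : Sym2 Vtx := s(a, b)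

notation "e(" a "," b ")" => edge a b

@[grind =]
theorem edge_eq_iff {a b c d : Vtx} : e(a, b) = e(c, d) ↔ a = c ∧ b = d ∨ a = d ∧ b = c :=
  Sym2.eq_iff

@[grind =]
theorem mem_edge {a b v : Vtx} : v ∈ e(a, b) ↔ v = a ∨ v = b := Sym2.mem_iff

@[grind =]
theorem edge_comm (a b : Vtx) : e(a, b) = e(b, a) := Sym2.eq_swap

theorem left_mem_edge (a b : Vtx) : a ∈ e(a, b) := Sym2.mem_mk_left a b

theorem right_mem_edge (a b : Vtx) : b ∈ e(a, b) := Sym2.mem_mk_right a b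

theorem exists_edge (e : Sym2 Vtx) : ∃ a b, e = e(a, b) := by
  induction e with | _ a b
  exact ⟨a, b, rfl⟩

theorem edge_injective (a : Vtx) : Function.Injective (edge a) := by
  intro b c
  grind

/-- The pair `e` is an edge of the board. -/
def Legal (e : Sym2 Vtx) : Prop := e ∈ twoKomega.edgeSet

theorem legal_mk {a b : Vtx} : Legal e(a, b) ↔ a ≠ b ∧ a.side = b.side := by
  have key : ∀ a b : ℕ ⊕ ℕ, s(a, b) ∈ twoKomega.edgeSet ↔ a ≠ b ∧ a.isLeft = b.isLeft := by
    rintro (a | a) (b | b) <;> simp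
  exact key a b

theorem not_legal_self (a : Vtx) : ¬ Legal e(a, a) := by simp [legal_mk]

/-- The pair `e` is an edge of the component number `i` of the board. -/
def InBoard (i : Bool) (e : Sym2 Vtx) : Prop := Legal e ∧ ∀ v ∈ e, v.side = i

theorem inBoard_mk {i : Bool} {a b : Vtx} :
    InBoard i e(a, b) ↔ a ≠ b ∧ a.side = i ∧ b.side = i := by
  simp only [InBoard, legal_mk, mem_edge]
  grind

theorem Legal.inBoard {e : Sym2 Vtx} (h : Legal e) (i : Bool) : InBoard i e ∨ InBoard (!i) e := by
  obtain ⟨a, b, rfl⟩ := exists_edge e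
  rw [legal_mk] at h
  rw [inBoard_mk, inBoard_mk]
  cases i <;> cases ha : a.side <;> grind

theorem InBoard.not_not {i : Bool} {e : Sym2 Vtx} (h : InBoard i e) : ¬ InBoard (!i) e := by
  obtain ⟨a, b, rfl⟩ := exists_edge e
  rw [inBoard_mk] at *
  grind

/-! ### Books with four pages. -/

/-- The edges of the book with spine `p q` and set of pages `T`. -/
def book (p q : Vtx) (T : Finset Vtx) : Edges :=
  insert e(p, q) (T.image (edge p) ∪ T.image (edge q))

/-- `p q` and `T` are the spine and the pages of a book with four pages. -/
structure IsBook (p q : Vtx) (T : Finset Vtx) : Prop where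
  ne : p ≠ q
  left_notMem : p ∉ T
  right_notMem : q ∉ T
  card_pages : T.card = 4

/-- The edge set `E` contains a book with four pages. -/
def HasBook (E : Edges) : Prop := ∃ p q T, IsBook p q T ∧ book p q T ⊆ E

theorem mem_book {p q : Vtx} {T : Finset Vtx} {e : Sym2 Vtx} :
    e ∈ book p q T ↔ e = e(p, q) ∨ ∃ t ∈ T, e = e(p, t) ∨ e = e(q, t) := by
  simp only [book, Finset.mem_insert, Finset.mem_union, Finset.mem_image]
  grind

theorem book_subset_iff {p q : Vtx} {T : Finset Vtx} {E : Edges} :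
    book p q T ⊆ E ↔ e(p, q) ∈ E ∧ ∀ t ∈ T, e(p, t) ∈ E ∧ e(q, t) ∈ E := by
  constructor
  · intro h
    exact ⟨h (mem_book.2 (Or.inl rfl)), fun t ht =>
      ⟨h (mem_book.2 (Or.inr ⟨t, ht, Or.inl rfl⟩)), h (mem_book.2 (Or.inr ⟨t, ht, Or.inr rfl⟩))⟩⟩
  · rintro ⟨h1, h2⟩ e he
    rcases mem_book.1 he with rfl | ⟨t, ht, rfl | rfl⟩
    exacts [h1, (h2 t ht).1, (h2 t ht).2]

theorem IsBook.symm {p q : Vtx} {T : Finset Vtx} (h : IsBook p q T) : IsBook q p T :=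
  ⟨h.ne.symm, h.right_notMem, h.left_notMem, h.card_pages⟩

theorem book_symm (p q : Vtx) (T : Finset Vtx) : book q p T = book p q T := by
  ext e
  simp only [mem_book, edge_comm q p]
  grind

theorem HasBook.mono {E F : Edges} (h : HasBook E) (hEF : E ⊆ F) : HasBook F :=
  let ⟨p, q, T, hb, hs⟩ := h
  ⟨p, q, T, hb, hs.trans hEF⟩

theorem IsBook.card_book {p q : Vtx} {T : Finset Vtx} (h : IsBook p q T) :
    (book p q T).card = 9 := by
  obtain ⟨h1, h2, h3, h4⟩ := h
  rw [book, Finset.card_insert_of_notMem, Finset.card_union_of_disjoint,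
    Finset.card_image_of_injective, Finset.card_image_of_injective, h4]
  · exact edge_injective q
  · exact edge_injective p
  · rw [Finset.disjoint_left]
    simp only [Finset.mem_image]
    grind
  · simp only [Finset.mem_union, Finset.mem_image]
    grind

theorem HasBook.le_card {E : Edges} (h : HasBook E) : 9 ≤ E.card := by
  obtain ⟨p, q, T, hb, hs⟩ := h
  exact hb.card_book ▸ Finset.card_le_card hs

/-- A spine vertex of a book has degree five. -/
theorem IsBook.five_le {p q : Vtx} {T : Finset Vtx} (h : IsBook p q T) {X : Edges}
    (hX : ∀ e ∈ book p q T, p ∈ e → e ∈ X) : 5 ≤ X.card := by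
  have hc : ((insert q T).image (edge p)).card = 5 := by
    rw [Finset.card_image_of_injective _ (edge_injective p),
      Finset.card_insert_of_notMem h.right_notMem, h.card_pages]
  rw [← hc]
  refine Finset.card_le_card fun e he => ?_
  obtain ⟨t, ht, rfl⟩ := Finset.mem_image.1 he
  refine hX _ (mem_book.2 ?_) (left_mem_edge _ _)
  grind

theorem hub_of_mem_book {p q : Vtx} {T : Finset Vtx} {e : Sym2 Vtx} (h : e ∈ book p q T) :
    p ∈ e ∨ q ∈ e := by
  rcases mem_book.1 h with rfl | ⟨t, ht, rfl | rfl⟩ <;> grind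

/-- A spine vertex of a book is joined in it to all its other vertices. -/
theorem IsBook.mk_mem_of_mem {p q v : Vtx} {T : Finset Vtx} {e : Sym2 Vtx}
    (h : e ∈ book p q T) (hv : v ∈ e) (hne : v ≠ p) : e(p, v) ∈ book p q T := by
  rw [mem_book] at *
  rcases h with rfl | ⟨t, ht, rfl | rfl⟩ <;> rw [mem_edge] at hv <;> grind

/-- A book is connected, so the component of one end of its spine contains all of it. -/
theorem HasBook.of_union {i : Bool} {A N : Edges} (hA : ∀ e ∈ A, InBoard i e)
    (hN : ∀ e ∈ N, InBoard (!i) e) (h : HasBook (A ∪ N)) : HasBook A ∨ HasBook N := by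
  obtain ⟨p, q, T, hb, hs⟩ := h
  rw [book_subset_iff] at hs
  have key : ∀ a b, e(a, b) ∈ A ∪ N →
      (a.side = i → e(a, b) ∈ A) ∧ (a.side = (!i) → e(a, b) ∈ N) ∧ a.side = b.side := by
    intro a b hab
    rcases Finset.mem_union.1 hab with h | h
    · have := hA _ h
      rw [inBoard_mk] at this
      grind
    · have := hN _ h
      rw [inBoard_mk] at this
      grind
  have hpq := key p q hs.1
  by_cases hp : p.side = i
  · left
    refine ⟨p, q, T, hb, book_subset_iff.2 ⟨hpq.1 hp, fun t ht => ?_⟩⟩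
    exact ⟨(key _ _ (hs.2 t ht).1).1 hp, (key _ _ (hs.2 t ht).2).1 (hpq.2.2 ▸ hp)⟩
  · right
    have hp' : p.side = !i := by cases i <;> simp_all
    refine ⟨p, q, T, hb, book_subset_iff.2 ⟨hpq.2.1 hp', fun t ht => ?_⟩⟩
    exact ⟨(key _ _ (hs.2 t ht).1).2.1 hp', (key _ _ (hs.2 t ht).2).2.1 (hpq.2.2 ▸ hp')⟩

/-- In each component there are vertices outside any finite set. -/
theorem exists_fresh (i : Bool) (S : Finset Vtx) : ∃ v : Vtx, v.side = i ∧ v ∉ S := by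
  have hinf : {v : Vtx | v.side = i}.Infinite := by
    cases i
    · refine Set.Infinite.mono (s := Set.range (Sum.inr : ℕ → ℕ ⊕ ℕ)) ?_
        (Set.infinite_range_of_injective Sum.inr_injective)
      rintro _ ⟨n, rfl⟩; rfl
    · refine Set.Infinite.mono (s := Set.range (Sum.inl : ℕ → ℕ ⊕ ℕ)) ?_
        (Set.infinite_range_of_injective Sum.inl_injective)
      rintro _ ⟨n, rfl⟩; rfl
  obtain ⟨v, hv, hv'⟩ := hinf.exists_notMem_finset S
  exact ⟨v, hv, hv'⟩

/-- In each component there are vertices outside any finite set which are not covered by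
a given finite set of edges. -/
theorem exists_untouched (i : Bool) (S : Finset Vtx) (E : Edges) :
    ∃ v : Vtx, v.side = i ∧ v ∉ S ∧ ∀ e ∈ E, v ∉ e := by
  obtain ⟨v, hv, hv'⟩ := exists_fresh i (S ∪ E.biUnion Sym2.toFinset)
  refine ⟨v, hv, fun h => hv' (Finset.mem_union_left _ h), fun e he hve => hv' ?_⟩
  exact Finset.mem_union_right _ (Finset.mem_biUnion.2 ⟨e, he, by simpa using hve⟩)

/-! ### Survival of the second player as a coinductive notion. -/

/-- The second player can avoid losing when the first player, who owns `E₁`, is to move against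
a second player who owns `E₂`. -/
def Surv (E₁ E₂ : Edges) : Prop :=
  ∃ I : Edges → Edges → Prop, I E₁ E₂ ∧ ∀ A B, I A B → ∀ f, Legal f → f ∉ A → f ∉ B →
    ¬ HasBook (insert f A) ∧ ∃ g, Legal g ∧ g ∉ insert f A ∧ g ∉ B ∧
      (HasBook (insert g B) ∨ I (insert f A) (insert g B))

/-- The second player can avoid losing when he is to move. -/
def Reply (E₁ E₂ : Edges) : Prop :=
  ∃ g, Legal g ∧ g ∉ E₁ ∧ g ∉ E₂ ∧ (HasBook (insert g E₂) ∨ Surv E₁ (insert g E₂))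

theorem Surv.step {E₁ E₂ : Edges} (h : Surv E₁ E₂) {f : Sym2 Vtx} (hf : Legal f)
    (h1 : f ∉ E₁) (h2 : f ∉ E₂) : ¬ HasBook (insert f E₁) ∧ Reply (insert f E₁) E₂ := by
  obtain ⟨I, hI, hstep⟩ := h
  obtain ⟨hn, g, hg, hg1, hg2, h⟩ := hstep _ _ hI f hf h1 h2
  exact ⟨hn, g, hg, hg1, hg2, h.imp_right fun h => ⟨I, h, hstep⟩⟩

/-- The witnessing invariant is `I` together with `Surv` itself, so a strategy may leave `I` for any
position already known to survive. -/
theorem surv_coinduct (I : Edges → Edges → Prop)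
    (hI : ∀ A B, I A B → ∀ f, Legal f → f ∉ A → f ∉ B →
      ¬ HasBook (insert f A) ∧ (Reply (insert f A) B ∨
        ∃ g, Legal g ∧ g ∉ insert f A ∧ g ∉ B ∧ I (insert f A) (insert g B)))
    {E₁ E₂ : Edges} (h : I E₁ E₂) : Surv E₁ E₂ := by
  refine ⟨fun A B => Surv A B ∨ I A B, Or.inr h, ?_⟩
  rintro A B (hS | hS) f hf h1 h2
  · obtain ⟨hn, g, hg, hg1, hg2, h⟩ := hS.step hf h1 h2
    exact ⟨hn, g, hg, hg1, hg2, h.imp_right Or.inl⟩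
  · obtain ⟨hn, ⟨g, hg, hg1, hg2, h⟩ | ⟨g, hg, hg1, hg2, h⟩⟩ := hI A B hS f hf h1 h2
    · exact ⟨hn, g, hg, hg1, hg2, h.imp_right Or.inl⟩
    · exact ⟨hn, g, hg, hg1, hg2, Or.inr (Or.inr h)⟩

theorem surv_of_reply {E₁ E₂ : Edges} (h : ∀ f, Legal f → f ∉ E₁ → f ∉ E₂ →
    ¬ HasBook (insert f E₁) ∧ Reply (insert f E₁) E₂) : Surv E₁ E₂ :=
  surv_coinduct (fun A B => A = E₁ ∧ B = E₂)
    (by rintro _ _ ⟨rfl, rfl⟩ f hf h1 h2; exact (h f hf h1 h2).imp_right Or.inl) ⟨rfl, rfl⟩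

/-! ### Perpetual threats from three red pages. -/

/-- The pair `z s` is the spine of a red book with set of pages `T`. -/
structure Core (R : Edges) (z s : Vtx) (T : Finset Vtx) : Prop where
  spine : e(z, s) ∈ R
  card_pages : T.card = 3
  pages : ∀ t ∈ T, e(z, t) ∈ R ∧ e(s, t) ∈ R

theorem Core.mono {R R' : Edges} {z s : Vtx} {T : Finset Vtx} (h : Core R z s T) (hR : R ⊆ R') :
    Core R' z s T :=
  ⟨hR h.spine, h.card_pages, fun t ht => ⟨hR (h.pages t ht).1, hR (h.pages t ht).2⟩⟩

theorem Core.hasBook {R : Edges} {z s t : Vtx} {T : Finset Vtx} (h : Core R z s T)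
    (hR : ∀ e ∈ R, Legal e) (hst : e(s, t) ∈ R) (hzt : e(z, t) ∉ R) (hne : z ≠ t) :
    HasBook (insert e(z, t) R) := by
  have hself : ∀ a, e(a, a) ∉ R := fun a ha => not_legal_self a (hR _ ha)
  have h1 := h.spine
  have h2 := h.pages
  have ht : t ∉ T := fun ht => hzt (h2 t ht).1
  refine ⟨z, s, insert t T, ⟨?_, ?_, ?_, ?_⟩, ?_⟩
  · rintro rfl; exact hself _ h1
  · rw [Finset.mem_insert, not_or]; exact ⟨hne, fun hz => hself _ (h2 z hz).1⟩
  · rw [Finset.mem_insert, not_or]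
    exact ⟨fun h => hself _ (h ▸ hst), fun hs => hself _ (h2 s hs).2⟩
  · rw [Finset.card_insert_of_notMem ht, h.card_pages]
  · rw [book_subset_iff]
    grind

/-- The first player, who owns `E₁`, cannot complete a book in one move. -/
def Threatless (E₁ E₂ : Edges) : Prop := ∀ f, Legal f → f ∉ E₂ → ¬ HasBook (insert f E₁)

/-- No edge of `E` at `z` is the spine of a book in `E` with three pages. -/
def NoSpine (E : Edges) (z : Vtx) : Prop :=
  ∀ w, e(z, w) ∈ E → ∀ X : Finset Vtx, X.card = 3 → ¬ ∀ x ∈ X, e(z, x) ∈ E ∧ e(w, x) ∈ E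

/-- The position, with the first player to move, in which the second player threatens to play
`z t` and the first player threatens nothing. -/
structure Threat (z s : Vtx) (T : Finset Vtx) (E₁ E₂ : Edges) (t : Vtx) : Prop where
  legal_left : ∀ e ∈ E₁, Legal e
  legal_right : ∀ e ∈ E₂, Legal e
  disj : ∀ e ∈ E₂, e ∉ E₁
  core : Core E₂ z s T
  mem : e(s, t) ∈ E₂
  notMem : e(z, t) ∉ E₂
  ne : z ≠ t
  untouched : ∀ e ∈ E₁, t ∉ e
  threatless : Threatless E₁ E₂
  noSpine : NoSpine E₁ z

/-- At most two blue edges meet `t`, namely `z t` and `f`, so `t` cannot be an end of the spine. If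
the book uses `z t`, then `z` is an end of the spine, `t` is a page and `f` is the other edge at
`t`. Without `t` this is a blue book with three pages and spine at `z`, against `noSpine`. -/
theorem Threat.block {z s t : Vtx} {T : Finset Vtx} {E₁ E₂ : Edges} (h : Threat z s T E₁ E₂ t)
    (f : Sym2 Vtx) (hf : Legal f) (hf₂ : f ∉ E₂) :
    ¬ HasBook (insert f (insert e(z, t) E₁)) := by
  intro ⟨p, q, P, hb, hs⟩
  have hself : ∀ a, e(a, a) ∉ E₁ := fun a ha => not_legal_self a (h.legal_left _ ha)
  by_cases hmem : e(z, t) ∈ book p q P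
  swap
  · refine h.threatless f hf hf₂ ⟨p, q, P, hb, fun e he => ?_⟩
    have := hs he
    grind
  have hdeg : ∀ e ∈ book p q P, t ∈ e → e ∈ ({f, e(z, t)} : Edges) := by
    intro e he hte
    have := hs he
    have := h.untouched e
    grind
  have hcard : ({f, e(z, t)} : Edges).card ≤ 2 := Finset.card_le_two
  have htp : t ≠ p := by
    rintro rfl
    have := hb.five_le hdeg
    omega
  have htq : t ≠ q := by
    rintro rfl
    have := hb.symm.five_le (X := {f, e(z, t)}) (by rw [book_symm]; exact hdeg)
    omega
  wlog hz : p = z generalizing p q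
  · refine this q p hb.symm (by rwa [book_symm]) (by rwa [book_symm]) (by rwa [book_symm])
      htq htp ?_
    have := hub_of_mem_book hmem
    simp only [mem_edge] at this
    grind
  subst hz
  have hqt : e(q, t) ∈ book p q P := by
    rw [book_symm] at hmem ⊢
    exact IsBook.mk_mem_of_mem hmem (right_mem_edge _ _) htq
  have hfq : f = e(q, t) := by
    have := hdeg _ hqt (right_mem_edge _ _)
    have := hb.ne
    grind
  have ht : t ∈ P := by
    rw [mem_book] at hmem
    have := hb.left_notMem
    grind
  rw [book_subset_iff] at hs
  obtain ⟨hs1, hs2⟩ := hs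
  have h1 := hb.ne
  have h2 := hb.left_notMem
  have h3 := hb.right_notMem
  refine h.noSpine q ?_ (P.erase t) ?_ ?_
  · grind
  · rw [Finset.card_erase_of_mem ht, hb.card_pages]
  · intro x hx
    rw [Finset.mem_erase] at hx
    have := hs2 x hx.2
    grind

/-- The only blue edge at `t` is `z t`, so `t` is neither a page nor the other end of the spine. -/
theorem Threat.noSpine_block {z s t : Vtx} {T : Finset Vtx} {E₁ E₂ : Edges}
    (h : Threat z s T E₁ E₂ t) : NoSpine (insert e(z, t) E₁) z := by
  intro w hw X hX hall
  have hself : ∀ a, e(a, a) ∉ E₁ := fun a ha => not_legal_self a (h.legal_left _ ha)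
  have hu := h.untouched
  have hne := h.ne
  have htx : ∀ x, e(t, x) ∉ E₁ := fun x hx => hu _ hx (left_mem_edge _ _)
  by_cases hwt : w = t
  · subst hwt
    have hsub : X ⊆ {z} := by
      intro x hx
      have := (hall x hx).2
      have := htx x
      grind
    have := Finset.card_le_card hsub
    simp at this
    omega
  · have hzw : e(z, w) ∈ E₁ := by grind
    refine h.noSpine w hzw X hX fun x hx => ?_
    have hx := hall x hx
    have := htx x
    have := htx w
    grind

/-- If blue does not take `z t`, red completes his book there. If he does, the threat is renewed at
a fresh vertex `y`. -/
theorem Threat.surv {z s t : Vtx} {T : Finset Vtx} {E₁ E₂ : Edges}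
    (h : Threat z s T E₁ E₂ t) : Surv E₁ E₂ := by
  refine surv_coinduct (fun E₁ E₂ => ∃ t, Threat z s T E₁ E₂ t) ?_ ⟨t, h⟩
  rintro E₁ E₂ ⟨t, h⟩ f hf h1 h2
  refine ⟨h.threatless f hf h2, ?_⟩
  have hzs := legal_mk.1 (h.legal_right _ h.core.spine)
  have hst := legal_mk.1 (h.legal_right _ h.mem)
  by_cases hft : f = e(z, t)
  · right
    subst hft
    obtain ⟨y, hy, hyS, hyE⟩ := exists_untouched s.side {z, s} (insert e(z, t) (E₁ ∪ E₂))
    have hleg : Legal e(s, y) := legal_mk.2 ⟨by grind, hy.symm⟩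
    have hy1 : e(s, y) ∉ insert e(z, t) E₁ :=
      fun h => hyE e(s, y) (by grind) (right_mem_edge _ _)
    have hy2 : e(s, y) ∉ E₂ := fun h => hyE e(s, y) (by grind) (right_mem_edge _ _)
    have hy3 : e(z, y) ∉ E₂ := fun h => hyE e(z, y) (by grind) (right_mem_edge _ _)
    refine ⟨e(s, y), hleg, hy1, hy2, y, ?_⟩
    have := h.legal_left
    have := h.legal_right
    have := h.disj
    constructor
    · grind
    · grind
    · grind
    · exact h.core.mono (Finset.subset_insert _ _)
    · grind
    · grind
    · grind
    · intro e he
      exact hyE e (by grind)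
    · intro g hg hg2
      exact h.block g hg (by grind)
    · exact h.noSpine_block
  · left
    refine ⟨e(z, t), legal_mk.2 ⟨h.ne, hzs.2.trans hst.2⟩, ?_, h.notMem, Or.inl ?_⟩
    · rw [Finset.mem_insert, not_or]
      exact ⟨fun h => hft h.symm, fun h' => h.untouched _ h' (right_mem_edge _ _)⟩
    · exact h.core.hasBook h.legal_right h.mem h.notMem h.ne

/-! ### Starting the threats while blue has edges in both components. -/

/-- The first player's edges are `A` in the component `i` and `N` in the other one, the second
player's edges are `R`. -/
structure St (i : Bool) (A N R : Edges) : Prop where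
  left : ∀ e ∈ A, InBoard i e
  right : ∀ e ∈ N, InBoard (!i) e
  red : ∀ e ∈ R, Legal e
  disj : ∀ e ∈ R, e ∉ A ∧ e ∉ N

/-- After any two further moves in his component, the first player owns no book there, and after
any move there he owns no book with three pages whose spine contains `z`. -/
structure Robust (N R : Edges) (z : Vtx) : Prop where
  noBook : ∀ m f, Legal m → Legal f → m ∉ R → f ∉ R → ¬ HasBook (insert f (insert m N))
  noSpine : ∀ m, Legal m → m ∉ R → NoSpine (insert m N) z

theorem Robust.mono {N R R' : Edges} {z : Vtx} (h : Robust N R z) (hR : R ⊆ R') :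
    Robust N R' z :=
  ⟨fun m f hm hf hmR hfR => h.noBook m f hm hf (fun h => hmR (hR h)) (fun h => hfR (hR h)),
    fun m hm hmR => h.noSpine m hm fun h => hmR (hR h)⟩

/-- This is how the perpetual threats begin. `N` is a robust set, and `m` makes up for a last blue
move that may have enlarged it to `N'`. Blue is harmless in component `i` by `hA` and in the other
one by `hrob`. -/
theorem threat_reply {i : Bool} {A N N' R : Edges} {z s : Vtx} {T : Finset Vtx} {m : Sym2 Vtx}
    (hst : St i A N' R) (hz : z.side = !i) (hcore : Core R z s T) (hrob : Robust N R z)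
    (hN : N' ⊆ insert m N) (hm : Legal m) (hmR : m ∉ R)
    (hA : ∀ f, InBoard i f → f ∉ R → ¬ HasBook (insert f A)) : Reply (A ∪ N') R := by
  have hzs := legal_mk.1 (hst.red _ hcore.spine)
  obtain ⟨y, hy, hyS, hyE⟩ := exists_untouched s.side {z, s} ((A ∪ N') ∪ R)
  have hleg : Legal e(s, y) := legal_mk.2 ⟨by grind, hy.symm⟩
  have hy1 : e(s, y) ∉ A ∪ N' := fun h => hyE e(s, y) (by grind) (right_mem_edge _ _)
  have hy2 : e(s, y) ∉ R := fun h => hyE e(s, y) (by grind) (right_mem_edge _ _)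
  have hy3 : e(z, y) ∉ R := fun h => hyE e(z, y) (by grind) (right_mem_edge _ _)
  refine ⟨e(s, y), hleg, hy1, hy2, Or.inr (Threat.surv (z := z) (s := s) (T := T) (t := y) ?_)⟩
  have hdisj := hst.disj
  have hred := hst.red
  have hleft := hst.left
  have hright := hst.right
  constructor
  · intro e he
    rcases Finset.mem_union.1 he with h | h
    exacts [(hst.left e h).1, (hst.right e h).1]
  · grind
  · grind
  · exact hcore.mono (Finset.subset_insert _ _)
  · grind
  · grind
  · grind
  · intro e he
    exact hyE e (by grind)
  · intro f hf hfR hbook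
    have hfR' : f ∉ R := by grind
    rcases hf.inBoard i with hfi | hfi
    · have : insert f (A ∪ N') = insert f A ∪ N' := by grind
      rw [this] at hbook
      rcases hbook.of_union (by grind) hst.right with h | h
      · exact hA f hfi hfR' h
      · exact hrob.noBook m m hm hm hmR hmR (h.mono (by grind))
    · have : insert f (A ∪ N') = A ∪ insert f N' := by grind
      rw [this] at hbook
      rcases hbook.of_union hst.left (by grind) with h | h
      -- `hA` speaks only of `A` with an additional edge; an edge already in `A` can play that role.
      · by_cases hAe : A.Nonempty
        · obtain ⟨a, ha⟩ := hAe
          exact hA a (hst.left a ha) (fun h => (hdisj a h).1 ha) (h.mono (Finset.subset_insert _ _))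
        · rw [Finset.not_nonempty_iff_eq_empty] at hAe
          subst hAe
          simpa using h.le_card
      · exact hrob.noBook m f hm hf hmR hfR' (h.mono (by grind))
  · intro w hw X hX hall
    have hin : ∀ v, e(z, v) ∈ A ∪ N' → e(z, v) ∈ N' ∧ v.side = !i := by
      intro v hv
      rcases Finset.mem_union.1 hv with h | h
      · have := inBoard_mk.1 (hleft _ h)
        grind
      · exact ⟨h, (inBoard_mk.1 (hright _ h)).2.2⟩
    refine hrob.noSpine m hm hmR w (hN (hin w hw).1) X hX fun x hx => ?_
    have h1 := hall x hx
    refine ⟨hN (hin x h1.1).1, hN ?_⟩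
    rcases Finset.mem_union.1 h1.2 with h | h
    · have := inBoard_mk.1 (hleft _ h)
      have := hin w hw
      grind
    · exact h

/-! ### Pairing against blue's near-complete book. -/

/-- All edges in `A` meet `{p, q}`, and whenever `A` contains one of `p y` and `q y`, the other one
is in `A` or `R`; moreover `A` contains no book. -/
structure Paired (p q : Vtx) (A R : Edges) : Prop where
  incident : ∀ e ∈ A, p ∈ e ∨ q ∈ e
  spine : e(p, q) ∈ A ∨ e(p, q) ∈ R
  left : ∀ y, y ≠ q → e(p, y) ∈ A → e(q, y) ∈ A ∨ e(q, y) ∈ R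
  right : ∀ y, y ≠ p → e(q, y) ∈ A → e(p, y) ∈ A ∨ e(p, y) ∈ R
  noBook : ¬ HasBook A

theorem Paired.symm {p q : Vtx} {A R : Edges} (h : Paired p q A R) : Paired q p A R :=
  ⟨fun e he => (h.incident e he).symm, by rw [edge_comm q p]; exact h.spine, h.right, h.left,
    h.noBook⟩

/-- In a paired position a single edge, together with an edge not meeting the pair, never completes
a book. -/
theorem Paired.not_hasBook {p q : Vtx} {A R G : Edges} (h : Paired p q A R) (hpq : p ≠ q)
    {f : Sym2 Vtx} (hf : f ∉ R) (hG : G.card ≤ 1) (hGi : ∀ e ∈ G, p ∉ e ∧ q ∉ e) :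
    ¬ HasBook (insert f (A ∪ G)) := by
  rintro ⟨P, Q, T, hb, hs⟩
  have hinc := h.incident
  have hub : ∀ P Q T, IsBook P Q T → book P Q T ⊆ insert f (A ∪ G) → P = p ∨ P = q := by
    intro P Q T hb hs
    by_contra hne
    -- A vertex other than `p` and `q` meets at most four of the available edges: `f`, those to `p`
    -- and `q`, and the one in `G`. An end of a spine needs five.
    have := hb.five_le (X := insert f (insert e(P, p) (insert e(P, q) G))) (by
      intro e he hPe
      have h1 := hs he
      have h2 := hinc e
      obtain ⟨a, b, rfl⟩ := exists_edge e
      grind)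
    have h1 := Finset.card_insert_le f (insert e(P, p) (insert e(P, q) G))
    have h2 := Finset.card_insert_le e(P, p) (insert e(P, q) G)
    have h3 := Finset.card_insert_le e(P, q) G
    omega
  wlog hPp : P = p generalizing p q
  · refine this h.symm hpq.symm (fun e he => (hGi e he).symm) (fun e he => (hinc e he).symm)
      (fun P Q T h1 h2 => (hub P Q T h1 h2).symm) ?_
    have := hub P Q T hb hs
    grind
  have hQq : Q = q := by
    have := hub Q P T hb.symm (by rwa [book_symm])
    have := hb.ne
    grind
  subst hPp hQq
  have hmem : ∀ e ∈ book P Q T, e = f ∨ e ∈ A := by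
    intro e he
    have h1 := hs he
    have h2 := hub_of_mem_book he
    have h3 := hGi e
    grind
  -- If the book uses `f` at a page, it also uses the partner of `f`, which is then in `A`. By the
  -- pairing `f` is in `A` or `R`, and it is not in `R`; the same holds if `f` is the spine.
  have hcl : f ∈ book P Q T → f ∈ A := by
    intro hf'
    have h1 := h.spine
    have h2 := hb.ne
    have h3 := hb.left_notMem
    have h4 := hb.right_notMem
    rcases mem_book.1 hf' with rfl | ⟨t, ht, rfl | rfl⟩
    · grind
    · have := hmem e(Q, t) (mem_book.2 (Or.inr ⟨t, ht, Or.inr rfl⟩))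
      have := h.right t
      grind
    · have := hmem e(P, t) (mem_book.2 (Or.inr ⟨t, ht, Or.inl rfl⟩))
      have := h.left t
      grind
  refine h.noBook ⟨P, Q, T, hb, fun e he => ?_⟩
  rcases hmem e he with rfl | h
  exacts [hcl he, h]

/-- The reply to a move `p y` of the first player in a paired position. -/
theorem Paired.reply {i : Bool} {p q y z s : Vtx} {A N R : Edges} {T : Finset Vtx}
    (h : Paired p q A R) (hq : q.side = i) (hpq : p ≠ q) (hst : St i A N R)
    (hz : z.side = !i) (hcore : Core R z s T) (hrob : Robust N R z)
    (hf : InBoard i e(p, y)) (hfA : e(p, y) ∉ A) (hfR : e(p, y) ∉ R) :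
    Reply (insert e(p, y) A ∪ N) R ∨ ∃ g, Legal g ∧ g ∉ insert e(p, y) A ∪ N ∧ g ∉ R ∧
      St i (insert e(p, y) A) N (insert g R) ∧ Paired p q (insert e(p, y) A) (insert g R) := by
  have hyq : y ≠ q := by
    rintro rfl
    exact h.spine.elim hfA hfR
  have hy := inBoard_mk.1 hf
  have hleft := hst.left
  have hright := hst.right
  have hred := hst.red
  have hdisj := hst.disj
  have hin : InBoard i e(q, y) := inBoard_mk.2 ⟨hyq.symm, hq, hy.2.2⟩
  have hnb : ¬ HasBook (insert e(p, y) A) := by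
    simpa using h.not_hasBook (G := ∅) hpq hfR (by simp) (by simp)
  have hqA : e(q, y) ∉ A := fun hA => by
    have := h.right y hy.1.symm hA
    tauto
  have hqN : e(q, y) ∉ N := fun hN => hin.not_not (hright _ hN)
  have hi := h.incident
  have hs := h.spine
  have hl := h.left
  have hr := h.right
  -- If the partner is already red, the pairing needs no reply and red is free to start his threats.
  by_cases hqR : e(q, y) ∈ R
  · left
    have hP : Paired p q (insert e(p, y) A) R := by
      constructor
      · grind
      · grind
      · grind
      · grind
      · exact hnb
    refine threat_reply (m := e(p, y)) ⟨by grind, hright, hred, ?_⟩ hz hcore hrob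
      (Finset.subset_insert _ _) hf.1 hfR ?_
    · grind
    · intro f _ hfR
      simpa using hP.not_hasBook (G := ∅) hpq hfR (by simp) (by simp)
  · right
    refine ⟨e(q, y), hin.1, by grind, hqR, ⟨by grind, hright, ?_, ?_⟩, ⟨?_, ?_, ?_, ?_, hnb⟩⟩
    · have := hin.1
      grind
    · grind
    · grind
    · grind
    · grind
    · grind

/-- The second player does not lose when he pairs the edges at the two ends of the spine of
the first player's near-book, with a threat in reserve in the other component. -/
theorem Paired.surv {i : Bool} {p q z s : Vtx} {A N R : Edges} {T : Finset Vtx}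
    (h : Paired p q A R) (hp : p.side = i) (hq : q.side = i) (hpq : p ≠ q) (hst : St i A N R)
    (hz : z.side = !i) (hcore : Core R z s T) (hrob : Robust N R z) : Surv (A ∪ N) R := by
  refine surv_coinduct (fun E R => ∃ A, E = A ∪ N ∧ Paired p q A R ∧ St i A N R ∧
    Core R z s T ∧ Robust N R z) ?_ ⟨A, rfl, h, hst, hcore, hrob⟩
  rintro _ R ⟨A, rfl, h, hst, hcore, hrob⟩ f hf hfE hfR
  have hleft := hst.left
  have hright := hst.right
  have hred := hst.red
  have hdisj := hst.disj
  have hNb : ¬ HasBook (insert f N) := fun hb => hrob.noBook f f hf hf hfR hfR (hb.mono (by grind))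
  rcases hf.inBoard i with hfi | hfi
  · have hins : insert f (A ∪ N) = insert f A ∪ N := by grind
    rw [hins]
    have hAf : ¬ HasBook (insert f A) := by
      simpa using h.not_hasBook (G := ∅) hpq hfR (by simp) (by simp)
    refine ⟨fun hb => ?_, ?_⟩
    · rcases hb.of_union (i := i) (by grind) hright with hb | hb
      · exact hAf hb
      · exact hNb (hb.mono (Finset.subset_insert _ _))
    by_cases hinc : p ∈ f ∨ q ∈ f
    · have key : Reply (insert f A ∪ N) R ∨ ∃ g, Legal g ∧ g ∉ insert f A ∪ N ∧ g ∉ R ∧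
          St i (insert f A) N (insert g R) ∧ Paired p q (insert f A) (insert g R) := by
        rcases hinc with hinc | hinc
        · obtain ⟨y, rfl⟩ : ∃ y, f = e(p, y) := hinc
          exact h.reply hq hpq hst hz hcore hrob hfi (by grind) hfR
        · obtain ⟨y, rfl⟩ : ∃ y, f = e(q, y) := hinc
          rcases h.symm.reply hp hpq.symm hst hz hcore hrob hfi (by grind) hfR with
            h | ⟨g, h1, h2, h3, h4, h5⟩
          exacts [Or.inl h, Or.inr ⟨g, h1, h2, h3, h4, h5.symm⟩]
      rcases key with h | ⟨g, h1, h2, h3, h4, h5⟩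
      · exact Or.inl h
      · exact Or.inr ⟨g, h1, h2, h3, _, rfl, h5, h4, hcore.mono (Finset.subset_insert _ _),
          hrob.mono (Finset.subset_insert _ _)⟩
    · left
      refine threat_reply (m := f) ⟨by grind, hright, hred, by grind⟩ hz hcore hrob
        (Finset.subset_insert _ _) hf hfR ?_
      intro g _ hg
      have := h.not_hasBook (G := {f}) hpq hg (by simp) (by grind)
      refine fun hb => this (hb.mono ?_)
      grind
  · have hins : insert f (A ∪ N) = A ∪ insert f N := by grind
    rw [hins]
    refine ⟨fun hb => ?_, Or.inl ?_⟩
    · rcases hb.of_union hleft (by grind) with hb | hb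
      · exact h.noBook hb
      · exact hNb hb
    · refine threat_reply (m := f) ⟨hleft, by grind, hred, by grind⟩ hz hcore hrob
        subset_rfl hf hfR ?_
      intro g _ hg
      simpa using h.not_hasBook (G := ∅) hpq hg (by simp) (by simp)

/-- With a red book with three pages in a component where the first player has no counter-threat,
the second player does not lose as long as the first player has few edges elsewhere. -/
theorem core_surv {i : Bool} {z s : Vtx} {A N R : Edges} {T : Finset Vtx} (hst : St i A N R)
    (hz : z.side = !i) (hcore : Core R z s T) (hA : A.card ≤ 7) (hrob : Robust N R z) :
    Surv (A ∪ N) R := by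
  refine surv_of_reply fun f hf hfE hfR => ?_
  have hleft := hst.left
  have hright := hst.right
  have hred := hst.red
  have hdisj := hst.disj
  have hNb : ¬ HasBook (insert f N) := fun hb => hrob.noBook f f hf hf hfR hfR (hb.mono (by grind))
  rcases hf.inBoard i with hfi | hfi
  · have hins : insert f (A ∪ N) = insert f A ∪ N := by grind
    rw [hins]
    have hcard := Finset.card_insert_le f A
    have hst' : St i (insert f A) N R := ⟨by grind, hright, hred, by grind⟩
    refine ⟨fun hb => ?_, ?_⟩
    · rcases hb.of_union (i := i) hst'.left hright with hb | hb
      · have := hb.le_card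
        omega
      · exact hNb (hb.mono (Finset.subset_insert _ _))
    by_cases hth : ∀ g, InBoard i g → g ∉ R → ¬ HasBook (insert g (insert f A))
    · exact threat_reply (m := f) hst' hz hcore hrob (Finset.subset_insert _ _) hf hfR hth
    · push Not at hth
      obtain ⟨g, hg, hgR, p, q, P, hb, hs⟩ := hth
      have hcard' := Finset.card_insert_le g (insert f A)
      -- There are at most 7 + 2 = 9 edges here, so the threatened book uses all of them. Once red
      -- has taken `g`, blue's edges in this component are a book minus one edge, which is a paired
      -- position.
      have heq : book p q P = insert g (insert f A) :=
        Finset.eq_of_subset_of_card_le hs (by rw [hb.card_book]; omega)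
      have hg' : g ∉ insert f A := by
        intro hg'
        have := hb.card_book
        rw [heq, Finset.insert_eq_of_mem hg'] at this
        omega
      have hmem : ∀ e, e ∈ book p q P → e ∈ insert f A ∨ e = g := by
        intro e he
        rw [heq] at he
        grind
      have hmem' : ∀ e ∈ insert f A, e ∈ book p q P := fun e he => heq ▸ Finset.mem_insert_of_mem he
      have hpqi : InBoard i e(p, q) := by
        have := hmem _ (mem_book.2 (Or.inl rfl))
        have := hst'.left
        grind
      rw [inBoard_mk] at hpqi
      have hpair : Paired p q (insert f A) (insert g R) := by
        have cross : ∀ p q, IsBook p q P → book p q P = insert g (insert f A) →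
            ∀ y, y ≠ q → e(p, y) ∈ insert f A →
            e(q, y) ∈ insert f A ∨ e(q, y) ∈ insert g R := by
          intro p q hb heq y hy hpy
          have h1 : e(p, y) ∈ book p q P := heq ▸ Finset.mem_insert_of_mem hpy
          have h2 : e(q, y) ∈ book p q P := by
            rw [book_symm] at h1 ⊢
            exact IsBook.mk_mem_of_mem h1 (right_mem_edge _ _) hy
          rw [heq] at h2
          grind
        constructor
        · exact fun e he => hub_of_mem_book (hmem' e he)
        · have := hmem _ (mem_book.2 (Or.inl rfl))
          grind
        · exact cross p q hb heq
        · exact cross q p hb.symm (by rw [book_symm, heq])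
        · intro hb
          have := hb.le_card
          omega
      have hgN : g ∉ N := fun h => hg.not_not (hright _ h)
      refine ⟨g, hg.1, by grind, hgR, Or.inr ?_⟩
      refine hpair.surv hpqi.2.1 hpqi.2.2 hpqi.1 ⟨hst'.left, hright, ?_, ?_⟩ hz
        (hcore.mono (Finset.subset_insert _ _)) (hrob.mono (Finset.subset_insert _ _))
      · have := hg.1
        grind
      · grind
  · have hins : insert f (A ∪ N) = A ∪ insert f N := by grind
    rw [hins]
    refine ⟨fun hb => ?_, ?_⟩
    · rcases hb.of_union hleft (by grind) with hb | hb
      · have := hb.le_card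
        omega
      · exact hNb hb
    · refine threat_reply (m := f) ⟨hleft, by grind, hred, by grind⟩ hz hcore hrob
        subset_rfl hf hfR ?_
      intro g _ _ hb
      have := hb.le_card
      have := Finset.card_insert_le g A
      omega

/-! ### Safety at an end of the red spine. -/

/-- The first player's edges `N` contain neither a triangle `z w t` nor two paths `z t w`, for any
`w` which is not joined to `z` in red. -/
structure Safe (N R : Edges) (z : Vtx) : Prop where
  triangle : ∀ w t, w ≠ z → e(z, w) ∉ R → e(z, w) ∈ N → e(z, t) ∈ N → e(w, t) ∉ N
  paths : ∀ w t t', w ≠ z → e(z, w) ∉ R → t ≠ t' → e(z, t) ∈ N → e(w, t) ∈ N → e(z, t') ∈ N →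
    e(w, t') ∉ N

/-- At most five edges of any book without red edges are in `N`. -/
def Few (N R : Edges) : Prop :=
  ∀ p q T, IsBook p q T → Disjoint (book p q T) R → (book p q T ∩ N).card ≤ 5

theorem Safe.mono {N R R' : Edges} {z : Vtx} (h : Safe N R z) (hR : R ⊆ R') : Safe N R' z :=
  ⟨fun w t hw hzw => h.triangle w t hw fun h => hzw (hR h),
    fun w t t' hw hzw => h.paths w t t' hw fun h => hzw (hR h)⟩

theorem Few.mono {N R R' : Edges} (h : Few N R) (hR : R ⊆ R') : Few N R' :=
  fun p q T hb hd => h p q T hb (hd.mono_right hR)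

theorem few_of_card {N R : Edges} (h : N.card ≤ 5) : Few N R :=
  fun _ _ _ _ _ => (Finset.card_le_card Finset.inter_subset_right).trans h

/-- The star with centre `z` and set of leaves `L`. -/
def star (z : Vtx) (L : Finset Vtx) : Edges := L.image (edge z)

theorem mem_star {z : Vtx} {L : Finset Vtx} {e : Sym2 Vtx} :
    e ∈ star z L ↔ ∃ l ∈ L, e = e(z, l) := by
  simp only [star, Finset.mem_image]
  grind

theorem edge_mem_star {z a : Vtx} {L : Finset Vtx} (hz : z ∉ L) : e(z, a) ∈ star z L ↔ a ∈ L := by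
  rw [mem_star]
  grind

theorem edge_notMem_star {z a b : Vtx} {L : Finset Vtx} (ha : z ≠ a) (hb : z ≠ b) :
    e(a, b) ∉ star z L := by
  rw [mem_star]
  grind

/-- Few additional edges do not complete a book with spine `z q`, if the position is safe at `z` up
to a star at `z`. -/
theorem Safe.not_spine {N R D : Edges} {z q : Vtx} {L T : Finset Vtx} (h : Safe N R z)
    (hzL : z ∉ L) (hL : ∀ l ∈ L, ∀ e ∈ N, l ∉ e) (hD : D.card < T.card)
    (hq : z ≠ q) (hzT : z ∉ T) (hqT : q ∉ T) (hR : e(z, q) ∉ R)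
    (hs : e(z, q) ∈ N ∪ star z L ∪ D)
    (hall : ∀ t ∈ T, e(z, t) ∈ N ∪ star z L ∪ D ∧ e(q, t) ∈ N ∪ star z L ∪ D) : False := by
  simp only [Finset.mem_union, edge_mem_star hzL] at hs hall
  have hq' : ∀ t ∈ T, e(q, t) ∈ N ∨ e(q, t) ∈ D := by
    intro t ht
    have h1 : e(q, t) ∉ star z L := edge_notMem_star hq (by rintro rfl; exact hzT ht)
    have := hall t ht
    tauto
  -- No edge of `N` meets a leaf `q`, so `D` would have to supply an edge `q t` for every page.
  by_cases hqL : q ∈ L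
  · have hsub : T.image (edge q) ⊆ D := by
      intro e he
      obtain ⟨t, ht, rfl⟩ := Finset.mem_image.1 he
      exact (hq' t ht).resolve_left fun h => hL q hqL _ h (left_mem_edge _ _)
    have := Finset.card_le_card hsub
    rw [Finset.card_image_of_injective _ (edge_injective q)] at this
    omega
  have hzt : ∀ t ∈ T, e(z, t) ∈ D ∨ e(q, t) ∈ D ∨ (e(z, t) ∈ N ∧ e(q, t) ∈ N) := by
    intro t ht
    have h1 := hq' t ht
    have h2 := hall t ht
    have h3 : t ∈ L → e(q, t) ∉ N := fun h h' => hL t h _ h' (right_mem_edge _ _)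
    tauto
  let B := T.filter fun t => e(z, t) ∈ D ∨ e(q, t) ∈ D
  -- Each page in `B` uses its own edge of `D`, different from the spine. So at least one page lies
  -- entirely in `N`, and at least two do if the spine is in `D`; these are the two configurations
  -- that `Safe` excludes.
  have hB : B.card ≤ (D.erase e(z, q)).card := by
    refine Finset.card_le_card_of_injOn (fun t => if e(z, t) ∈ D then e(z, t) else e(q, t)) ?_ ?_
    · intro t ht
      simp only [B, Finset.coe_filter, Set.mem_ofPred_eq] at ht
      simp only [Finset.coe_erase, Set.mem_sdiff, Finset.mem_coe, Set.mem_singleton_iff]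
      grind
    · intro t ht t' ht' heq
      simp only [B, Finset.coe_filter, Set.mem_ofPred_eq] at ht ht'
      simp only at heq
      grind
  have hgood : ∀ t ∈ T \ B, e(z, t) ∈ N ∧ e(q, t) ∈ N := by
    intro t ht
    have := hzt t (Finset.mem_sdiff.1 ht).1
    grind
  have hcard : (T \ B).card + B.card = T.card :=
    Finset.card_sdiff_add_card_eq_card (Finset.filter_subset _ _)
  by_cases hzq : e(z, q) ∈ D
  · rw [Finset.card_erase_of_mem hzq] at hB
    have := Finset.card_pos.2 ⟨_, hzq⟩
    obtain ⟨t, ht, t', ht', hne⟩ := Finset.one_lt_card.1 (show 1 < (T \ B).card by omega)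
    exact h.paths q t t' hq.symm hR hne (hgood t ht).1 (hgood t ht).2 (hgood t' ht').1
      (hgood t' ht').2
  · have := Finset.card_erase_le (s := D) (a := e(z, q))
    obtain ⟨t, ht⟩ := Finset.card_pos.1 (show 0 < (T \ B).card by omega)
    exact h.triangle q t hq.symm hR (by tauto) (hgood t ht).1 (hgood t ht).2

/-- A spine at `z` is excluded by `Safe.not_spine`, as three edges are fewer than four pages. A leaf
has degree at most 1 + 3, too little for an end of a spine, so a book with spine away from `z` uses
no edge of the star. It then has at most 5 + 3 edges, but needs nine. -/
theorem Safe.not_hasBook {N R D : Edges} {z : Vtx} {L : Finset Vtx} (h : Safe N R z)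
    (hfew : Few N R) (hzL : z ∉ L) (hL : ∀ l ∈ L, ∀ e ∈ N, l ∉ e) (hD : D.card ≤ 3)
    (hdisj : ∀ e ∈ N ∪ star z L ∪ D, e ∉ R) : ¬ HasBook (N ∪ star z L ∪ D) := by
  rintro ⟨p, q, T, hb, hs⟩
  have hnot : ∀ p q T, IsBook p q T → book p q T ⊆ N ∪ star z L ∪ D → p ≠ z := by
    rintro p q T hb hs rfl
    have hs' := book_subset_iff.1 hs
    exact h.not_spine hzL hL (by rw [hb.card_pages]; omega) hb.ne hb.left_notMem hb.right_notMem
      (hdisj _ hs'.1) hs'.1 hs'.2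
  have hp := hnot p q T hb hs
  have hq := hnot q p T hb.symm (by rwa [book_symm])
  have hleaf : ∀ p q T, IsBook p q T → book p q T ⊆ N ∪ star z L ∪ D → p ≠ z → p ∉ L := by
    intro p q T hb hs hp hpL
    have := hb.five_le (X := insert e(z, p) D) (by
      intro e he hpe
      have h1 := hs he
      simp only [Finset.mem_union, mem_star] at h1
      rcases h1 with (h1 | ⟨l, _, rfl⟩) | h1
      · exact absurd hpe (hL p hpL e h1)
      · grind
      · exact Finset.mem_insert_of_mem h1)
    have := Finset.card_insert_le e(z, p) D
    omega
  have hpL := hleaf p q T hb hs hp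
  have hqL := hleaf q p T hb.symm (by rwa [book_symm]) hq
  have hs' : book p q T ⊆ (book p q T ∩ N) ∪ D := by
    intro e he
    have h1 := hs he
    simp only [Finset.mem_union, mem_star, Finset.mem_inter] at h1 ⊢
    rcases h1 with (h1 | ⟨l, hl, rfl⟩) | h1
    · exact Or.inl ⟨he, h1⟩
    · have := hub_of_mem_book he
      grind
    · exact Or.inr h1
  have h1 := Finset.card_le_card hs'
  have h2 := Finset.card_union_le (book p q T ∩ N) D
  have h3 := hfew p q T hb (Finset.disjoint_left.2 fun e he => hdisj e (hs he))
  have h4 := hb.card_book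
  omega

/-- `M` and two further moves make up the three edges allowed in `Safe.not_hasBook`; `M` and one
further move are fewer than three pages. -/
theorem Safe.robust {N R M : Edges} {z : Vtx} {L : Finset Vtx} (h : Safe N R z)
    (hfew : Few N R) (hzL : z ∉ L) (hL : ∀ l ∈ L, ∀ e ∈ N, l ∉ e) (hM : M.card ≤ 1)
    (hdisj : ∀ e ∈ N ∪ star z L ∪ M, e ∉ R) (hleg : ∀ e ∈ N ∪ star z L ∪ M, Legal e) :
    Robust (N ∪ star z L ∪ M) R z := by
  constructor
  · intro m f _ _ hmR hfR hb
    have h1 := Finset.card_insert_le m M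
    have h2 := Finset.card_insert_le f (insert m M)
    refine h.not_hasBook hfew hzL hL (D := insert f (insert m M)) (by omega) ?_ (hb.mono ?_)
    · grind
    · grind
  · intro m hm hmR w hw X hX hall
    have h1 := Finset.card_insert_le m M
    have hself : ∀ a, e(a, a) ∉ insert m (N ∪ star z L ∪ M) := by
      intro a ha
      refine not_legal_self a ?_
      grind
    have heq : insert m (N ∪ star z L ∪ M) = N ∪ star z L ∪ insert m M := by grind
    have hzw : z ≠ w := by
      rintro rfl
      exact hself _ hw
    refine h.not_spine hzL hL (D := insert m M) (T := X) (by omega) hzw ?_ ?_ ?_ (heq ▸ hw)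
      (fun t ht => heq ▸ hall t ht)
    · exact fun hz => hself z (hall z hz).1
    · exact fun hw => hself w (hall w hw).2
    · grind

/-! ### From two red pages to three. -/

/-- The position, with the first player to move, in which `z s` is the spine of a red book with
pages `x₁` and `x₂`, and `s y` is red. -/
structure HalfPage (i : Bool) (A N : Edges) (z s x₁ x₂ : Vtx) (E R : Edges) (L : Finset Vtx)
    (y : Vtx) : Prop where
  eq : E = A ∪ (N ∪ star z L)
  st : St i A (N ∪ star z L) R
  safe : Safe N R z
  few : Few N R
  notMem : z ∉ L
  leaves : ∀ l ∈ L, ∀ e ∈ N, l ∉ e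
  spine : e(z, s) ∈ R
  page₁ : e(z, x₁) ∈ R ∧ e(s, x₁) ∈ R
  page₂ : e(z, x₂) ∈ R ∧ e(s, x₂) ∈ R
  half : e(s, y) ∈ R
  open_half : e(z, y) ∉ R
  ne : z ≠ y
  untouched : ∀ e ∈ E, y ∉ e

/-- If blue takes `z y`, then `y` becomes a leaf of his star at `z`, and red repeats with a fresh
vertex. Otherwise red takes `z y` and has three pages; blue's last move is absorbed by the bound
seven in `core_surv` or by the spare edge in `Safe.robust`. -/
theorem HalfPage.surv {i : Bool} {A N E R : Edges} {z s x₁ x₂ y : Vtx} {L : Finset Vtx}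
    (h : HalfPage i A N z s x₁ x₂ E R L y) (hz : z.side = !i) (hA : A.card ≤ 6)
    (hx : x₁ ≠ x₂) : Surv E R := by
  refine surv_coinduct (fun E R => ∃ L y, HalfPage i A N z s x₁ x₂ E R L y) ?_ ⟨L, y, h⟩
  clear h E R L y
  rintro E R ⟨L, y, h⟩ f hf hfE hfR
  obtain ⟨hleft, hright, hred, hdisj⟩ := h.st
  have hself : ∀ a, e(a, a) ∉ R := fun a ha => not_legal_self a (hred _ ha)
  have hsp := h.spine
  have hp₁ := h.page₁
  have hp₂ := h.page₂
  have hhalf := h.half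
  have hopen := h.open_half
  have hunt := h.untouched
  have hzs := legal_mk.1 (hred _ hsp)
  have hsy := legal_mk.1 (hred _ hhalf)
  have hfN : ¬ HasBook (insert f (N ∪ star z L)) := by
    have h1 := h.safe.not_hasBook h.few h.notMem h.leaves (D := {f}) (by simp) (by grind)
    exact fun hb => h1 (hb.mono (by grind))
  have hcard := Finset.card_insert_le f A
  have hE := h.eq
  have hstar : ∀ l ∈ L, e(z, l) ∈ E := fun l hl => by
    rw [hE]
    exact Finset.mem_union_right _ (Finset.mem_union_right _ ((edge_mem_star h.notMem).2 hl))
  refine ⟨?_, ?_⟩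
  · rcases hf.inBoard i with hfi | hfi
    · have hins : insert f E = insert f A ∪ (N ∪ star z L) := by grind
      rw [hins]
      intro hb
      rcases hb.of_union (i := i) (by grind) hright with hb | hb
      · have := hb.le_card
        omega
      · exact hfN (hb.mono (Finset.subset_insert _ _))
    · have hins : insert f E = A ∪ insert f (N ∪ star z L) := by grind
      rw [hins]
      intro hb
      rcases hb.of_union hleft (by grind) with hb | hb
      · have := hb.le_card
        omega
      · exact hfN hb
  by_cases hfz : f = e(z, y)
  · right
    subst hfz
    obtain ⟨v, hv, hvS, hvE⟩ := exists_untouched s.side {z, s} (insert e(z, y) (E ∪ R))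
    have hleg : Legal e(s, v) := legal_mk.2 ⟨by grind, hv.symm⟩
    have hv1 : e(s, v) ∉ insert e(z, y) E :=
      fun h => hvE e(s, v) (by grind) (right_mem_edge _ _)
    have hv2 : e(s, v) ∉ R := fun h => hvE e(s, v) (by grind) (right_mem_edge _ _)
    have hv3 : e(z, v) ∉ R := fun h => hvE e(z, v) (by grind) (right_mem_edge _ _)
    have hins : star z (insert y L) = insert e(z, y) (star z L) := Finset.image_insert _ _ _
    have hyi : InBoard (!i) e(z, y) := inBoard_mk.2 ⟨h.ne, hz, by grind⟩
    refine ⟨e(s, v), hleg, hv1, hv2, insert y L, v, ?_⟩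
    constructor
    · grind
    · constructor
      · exact hleft
      · grind
      · grind
      · have : e(s, v) ∉ A ∧ e(s, v) ∉ insert e(z, y) (N ∪ star z L) := by grind
        grind
    · exact h.safe.mono (Finset.subset_insert _ _)
    · exact h.few.mono (Finset.subset_insert _ _)
    · have := h.ne
      have := h.notMem
      grind
    · intro l hl e he
      rcases Finset.mem_insert.1 hl with rfl | hl
      · exact hunt e (by grind)
      · exact h.leaves l hl e he
    · grind
    · grind
    · grind
    · grind
    · grind
    · grind
    · intro e he
      exact hvE e (by grind)
  · left
    have hyE : e(z, y) ∉ E := fun h' => hunt _ h' (right_mem_edge _ _)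
    refine ⟨e(z, y), legal_mk.2 ⟨h.ne, hzs.2.trans hsy.2⟩, by grind, hopen, Or.inr ?_⟩
    have hleg : Legal e(z, y) := legal_mk.2 ⟨h.ne, hzs.2.trans hsy.2⟩
    have hcore : Core (insert e(z, y) R) z s {x₁, x₂, y} := by
      constructor
      · grind
      · rw [Finset.card_eq_three]
        refine ⟨x₁, x₂, y, hx, ?_, ?_, rfl⟩
        · rintro rfl; exact hopen hp₁.1
        · rintro rfl; exact hopen hp₂.1
      · intro t ht
        simp only [Finset.mem_insert, Finset.mem_singleton] at ht
        clear hdisj hE hstar hunt hright hleft hred hself hfN h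
        grind
    rcases hf.inBoard i with hfi | hfi
    · have hins : insert f E = insert f A ∪ (N ∪ star z L) := by grind
      rw [hins]
      have hrob := h.safe.robust h.few h.notMem h.leaves (M := ∅) (by simp) (by grind) (by
        intro e he
        have := hright e (by grind)
        exact this.1)
      rw [Finset.union_empty] at hrob
      refine core_surv (i := i) (T := {x₁, x₂, y}) ⟨by grind, hright, by grind, ?_⟩ hz hcore
        (by omega) (hrob.mono (Finset.subset_insert _ _))
      intro e he
      rcases Finset.mem_insert.1 he with rfl | he
      · clear hdisj hright hleft hred hself hstar hunt
        grind
      · have := hdisj e he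
        grind
    · have hins : insert f E = A ∪ (N ∪ star z L ∪ {f}) := by grind
      rw [hins]
      have hrob := h.safe.robust h.few h.notMem h.leaves (M := {f}) (by simp) (by grind) (by
        intro e he
        have : InBoard (!i) e := by grind
        exact this.1)
      refine core_surv (i := i) (T := {x₁, x₂, y}) ⟨hleft, by grind, by grind, ?_⟩ hz hcore
        (by omega) (hrob.mono (Finset.subset_insert _ _))
      grind

/-- With a red book with two pages, the position being safe at an end of its spine, the second
player does not lose. -/
theorem safe_reply {i : Bool} {A N R : Edges} {z s x₁ x₂ : Vtx} (hst : St i A N R)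
    (hz : z.side = !i) (hA : A.card ≤ 6) (hx : x₁ ≠ x₂) (hsp : e(z, s) ∈ R)
    (hp₁ : e(z, x₁) ∈ R ∧ e(s, x₁) ∈ R) (hp₂ : e(z, x₂) ∈ R ∧ e(s, x₂) ∈ R)
    (hsafe : Safe N R z) (hfew : Few N R) : Reply (A ∪ N) R := by
  obtain ⟨hleft, hright, hred, hdisj⟩ := hst
  have hzs := legal_mk.1 (hred _ hsp)
  obtain ⟨v, hv, hvS, hvE⟩ := exists_untouched s.side {z, s} (A ∪ N ∪ R)
  have hleg : Legal e(s, v) := legal_mk.2 ⟨by grind, hv.symm⟩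
  have hv1 : e(s, v) ∉ A ∪ N := fun h => hvE e(s, v) (by grind) (right_mem_edge _ _)
  have hv2 : e(s, v) ∉ R := fun h => hvE e(s, v) (by grind) (right_mem_edge _ _)
  have hv3 : e(z, v) ∉ R := fun h => hvE e(z, v) (by grind) (right_mem_edge _ _)
  have hstar : star z ∅ = ∅ := Finset.image_empty _
  refine ⟨e(s, v), hleg, hv1, hv2, Or.inr
    (HalfPage.surv (i := i) (A := A) (N := N) (L := ∅) (y := v) (z := z) (s := s) (x₁ := x₁)
      (x₂ := x₂) ?_ hz hA hx)⟩
  constructor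
  · rw [hstar, Finset.union_empty]
  · rw [hstar, Finset.union_empty]
    exact ⟨hleft, hright, by grind, by grind⟩
  · exact hsafe.mono (Finset.subset_insert _ _)
  · exact hfew.mono (Finset.subset_insert _ _)
  · simp
  · simp
  · grind
  · grind
  · grind
  · grind
  · grind
  · grind
  · intro e he
    exact hvE e (by grind)

/-- The two ends of the spine play symmetric roles, so safety at either of them suffices. -/
theorem diamond_reply {i : Bool} {A N R : Edges} {u s x₁ x₂ : Vtx} (hst : St i A N R)
    (hu : u.side = !i) (hA : A.card ≤ 6) (hx : x₁ ≠ x₂) (hus : e(u, s) ∈ R)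
    (hu₁ : e(u, x₁) ∈ R) (hs₁ : e(s, x₁) ∈ R) (hu₂ : e(u, x₂) ∈ R) (hs₂ : e(s, x₂) ∈ R)
    (hfew : Few N R) (hsafe : Safe N R u ∨ Safe N R s) : Reply (A ∪ N) R := by
  rcases hsafe with h | h
  · exact safe_reply hst hu hA hx hus ⟨hu₁, hs₁⟩ ⟨hu₂, hs₂⟩ h hfew
  · refine safe_reply hst ?_ hA hx (edge_comm u s ▸ hus) ⟨hs₁, hu₁⟩ ⟨hs₂, hu₂⟩ h hfew
    rw [← hu, (legal_mk.1 (hst.red _ hus)).2]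

/-! ### Counting blue edges to obtain `Safe` and `Few`. -/

/-- Both violations of `Safe` have a common shape: two blue edges at `z`, each continued by a blue
edge to a vertex not joined to `z` in red. For a triangle the two continuations are the same edge.
-/
theorem exists_of_not_safe {N R : Edges} {z : Vtx} (hN : ∀ e ∈ N, Legal e) (hR : ∀ e ∈ N, e ∉ R)
    (h : ¬ Safe N R z) : ∃ p q a b, p ≠ q ∧ a ≠ z ∧ b ≠ z ∧ e(z, a) ∉ R ∧ e(z, b) ∉ R ∧
      e(z, p) ∈ N ∧ e(z, q) ∈ N ∧ e(a, p) ∈ N ∧ e(b, q) ∈ N := by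
  by_contra hne
  refine h ⟨?_, ?_⟩
  · intro w t hw hzw h1 h2 h3
    have h4 := legal_mk.1 (hN _ h3)
    have h5 := legal_mk.1 (hN _ h2)
    exact hne ⟨w, t, t, w, h4.1, h5.1.symm, hw, hR _ h2, hzw, h1, h2, edge_comm w t ▸ h3, h3⟩
  · intro w t t' hw hzw htt h1 h2 h3 h4
    exact hne ⟨t, t', w, w, htt, hw, hw, hzw, hzw, h1, h3, h2, h4⟩

/-- If the position is unsafe at both ends of a red edge, the first player needs five edges apart
from those which miss that edge and meet the red neighbourhood of one end. -/
theorem exists_of_not_safe_pair {N R X : Edges} {u s : Vtx} (hN : ∀ e ∈ N, Legal e)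
    (hR : ∀ e ∈ N, e ∉ R) (hne : u ≠ s)
    (hus : e(u, s) ∈ R) (hX : X ⊆ N)
    (hXu : ∀ e ∈ X, u ∉ e ∧ s ∉ e ∧ ∃ v ∈ e, e(u, v) ∈ R)
    (hu : ¬ Safe N R u) (hs : ¬ Safe N R s) :
    ∃ Y ⊆ N, Y.card = X.card + 5 ∧ ∀ x, e(s, x) ∈ Y → e(u, x) ∈ R → x ≠ u →
      ∃ w, w ≠ s ∧ e(s, w) ∉ R ∧ e(w, x) ∈ N ∧ (e(w, x) ∈ Y → e(x, w) ∈ X) := by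
  obtain ⟨p, q, a, b, hpq, ha, hb, hua, hub, hup, huq, hap, hbq⟩ := exists_of_not_safe hN hR hu
  obtain ⟨p', q', a', b', hpq', ha', hb', hsa, hsb, hsp, hsq, hap', hbq'⟩ :=
    exists_of_not_safe hN hR hs
  have hself : ∀ v, e(v, v) ∉ N := fun v hv => not_legal_self v (hN _ hv)
  have hpu : p ≠ u := fun h => hself u (h ▸ hup)
  have hqu : q ≠ u := fun h => hself u (h ▸ huq)
  have hps : p ≠ s := fun h => hR _ hup (h ▸ hus)
  have hqs : q ≠ s := fun h => hR _ huq (h ▸ hus)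
  have has : a ≠ s := fun h => hua (h ▸ hus)
  have hps' : p' ≠ s := fun h => hself s (h ▸ hsp)
  have hqs' : q' ≠ s := fun h => hself s (h ▸ hsq)
  have hpR := hR _ hup
  have hqR := hR _ huq
  have hpu' : p' ≠ u := fun h => hR _ hsp (h ▸ edge_comm u s ▸ hus)
  have hqu' : q' ≠ u := fun h => hR _ hsq (h ▸ edge_comm u s ▸ hus)
  -- Neither end of `a p` is a red neighbour of `u`: `a` by choice, `p` because `u p` is blue.
  have hapX : e(a, p) ∉ X := by
    intro h
    obtain ⟨_, _, v, hv, hv'⟩ := hXu _ h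
    grind
  have huX : ∀ v, e(u, v) ∉ X := fun v h => (hXu _ h).1 (left_mem_edge _ _)
  have hsX : ∀ v, e(s, v) ∉ X := fun v h => (hXu _ h).2.1 (left_mem_edge _ _)
  have n1 : e(u, p) ≠ e(u, q) := by clear * - hpq; grind
  have n2 : e(u, p) ≠ e(a, p) := by clear * - ha hpu; grind
  have n3 : ∀ v, e(u, p) ≠ e(s, v) := by clear * - hne hps; grind
  have n4 : e(u, q) ≠ e(a, p) := by clear * - ha hpu; grind
  have n5 : ∀ v, e(u, q) ≠ e(s, v) := by clear * - hne hqs; grind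
  have n6 : ∀ v, e(a, p) ≠ e(s, v) := by clear * - has hps; grind
  have n7 : e(s, p') ≠ e(s, q') := by clear * - hpq'; grind
  refine ⟨insert e(u, p) (insert e(u, q) (insert e(a, p) (insert e(s, p') (insert e(s, q') X)))),
    ?_, ?_, ?_⟩
  · simp only [Finset.insert_subset_iff]
    exact ⟨hup, huq, hap, hsp, hsq, hX⟩
  · rw [Finset.card_insert_of_notMem, Finset.card_insert_of_notMem,
      Finset.card_insert_of_notMem, Finset.card_insert_of_notMem,
      Finset.card_insert_of_notMem (hsX q')]
    all_goals simp only [Finset.mem_insert, not_or]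
    · exact ⟨n7, hsX p'⟩
    · exact ⟨n6 p', n6 q', hapX⟩
    · exact ⟨n4, n5 p', n5 q', huX q⟩
    · exact ⟨n1, n2, n3 p', n3 q', huX p⟩
  · intro x hx hux hxu
    simp only [Finset.mem_insert] at hx ⊢
    have hx' : x = p' ∨ x = q' := by
      have := n3 x
      have := n5 x
      have := n6 x
      have := hsX x
      clear * - hx n3 n5 n6 hsX
      grind
    have hxs : x ≠ s := by grind
    -- As `x` is a red neighbour of `u`, the edge `w x` is none of `u p`, `u q`, `a p`; as it misses
    -- `s`, it is none of the other two. Only `X` remains.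
    have final : ∀ w, w ≠ s → (e(w, x) = e(u, p) ∨ e(w, x) = e(u, q) ∨ e(w, x) = e(a, p) ∨
        e(w, x) = e(s, p') ∨ e(w, x) = e(s, q') ∨ e(w, x) ∈ X) → e(x, w) ∈ X := by
      intro w hw h
      clear * - h hw hxs hxu hux hua hpR hqR
      grind
    rcases hx' with rfl | rfl
    · exact ⟨a', ha', hsa, hap', final a' ha'⟩
    · exact ⟨b', hb', hsb, hbq', final b' hb'⟩

theorem safe_or_of_card {N R X : Edges} {u s : Vtx} (hN : ∀ e ∈ N, Legal e)
    (hR : ∀ e ∈ N, e ∉ R) (hne : u ≠ s)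
    (hus : e(u, s) ∈ R) (hX : X ⊆ N)
    (hXu : ∀ e ∈ X, u ∉ e ∧ s ∉ e ∧ ∃ v ∈ e, e(u, v) ∈ R) (hcard : N.card ≤ X.card + 4) :
    Safe N R u ∨ Safe N R s := by
  by_contra! h
  obtain ⟨Y, hY, hYc, -⟩ := exists_of_not_safe_pair hN hR hne hus hX hXu h.1 h.2
  have := Finset.card_le_card hY
  omega

/-- If both ends were unsafe, the count would be tight and `Y` would be all of `N`. The blue edge
continuing `s x` to a vertex not joined to `s` in red would then lie in `X`, against `hx`. -/
theorem safe_or_of_mem {N R X : Edges} {u s x : Vtx} (hN : ∀ e ∈ N, Legal e)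
    (hR : ∀ e ∈ N, e ∉ R) (hne : u ≠ s)
    (hus : e(u, s) ∈ R) (hX : X ⊆ N)
    (hXu : ∀ e ∈ X, u ∉ e ∧ s ∉ e ∧ ∃ v ∈ e, e(u, v) ∈ R) (hcard : N.card ≤ X.card + 5)
    (hsx : e(s, x) ∈ N) (hux : e(u, x) ∈ R) (hxu : x ≠ u)
    (hx : ∀ v, e(x, v) ∈ X → e(s, v) ∈ R) : Safe N R u ∨ Safe N R s := by
  by_contra! h
  obtain ⟨Y, hY, hYc, hw⟩ := exists_of_not_safe_pair hN hR hne hus hX hXu h.1 h.2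
  have hYN : Y = N := Finset.eq_of_subset_of_card_le hY (by omega)
  subst hYN
  obtain ⟨w, _, h1, h2, h3⟩ := hw x hsx hux hxu
  exact h1 (hx w (h3 h2))

/-- `Few` holds if any book without red edges misses enough edges of `N`. -/
theorem few_of_missing {N R : Edges}
    (h : ∀ p q T, IsBook p q T → Disjoint (book p q T) R →
      ∃ D ⊆ N, N.card ≤ D.card + 5 ∧ ∀ e ∈ D, e ∉ book p q T) : Few N R := by
  intro p q T hb hd
  obtain ⟨D, hD, hc, hDb⟩ := h p q T hb hd
  have hsub : book p q T ∩ N ⊆ N \ D := by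
    intro e he
    grind
  have h1 := Finset.card_le_card hsub
  have h2 := Finset.card_sdiff_add_card_eq_card hD
  omega

/-- A book without red edges does not contain an edge both ends of which are joined in red to
vertices of the book. -/
theorem notMem_book_of_red {p q a b c d : Vtx} {T : Finset Vtx} {R : Edges} {f g : Sym2 Vtx}
    (hR : ∀ e ∈ R, Legal e) (hd : Disjoint (book p q T) R) (hf : f ∈ book p q T)
    (hg : g ∈ book p q T) (hc : c ∈ f) (hd' : d ∈ g) (hac : e(a, c) ∈ R) (hbd : e(b, d) ∈ R) :
    e(a, b) ∉ book p q T := by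
  intro hab
  rw [Finset.disjoint_left] at hd
  have hac' := (legal_mk.1 (hR _ hac)).1
  have hbd' := (legal_mk.1 (hR _ hbd)).1
  have key : ∀ p q, (∀ e ∈ book p q T, e ∉ R) → f ∈ book p q T → g ∈ book p q T →
      p ∉ e(a, b) := by
    intro p q hd hf hg hp
    rcases mem_edge.1 hp with rfl | rfl
    · exact hd _ (IsBook.mk_mem_of_mem hf hc hac'.symm) hac
    · exact hd _ (IsBook.mk_mem_of_mem hg hd' hbd'.symm) hbd
  rcases hub_of_mem_book hab with h | h
  · exact key p q hd hf hg h
  · rw [← book_symm] at hf hg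
    exact key q p (by rwa [book_symm]) hf hg h

/-! ### Single rounds of the opening. -/

/-- The edge sets of the first player before and after one of his moves. -/
structure Move (A N A' N' : Edges) : Prop where
  left : A ⊆ A'
  right : N ⊆ N'
  card : A'.card + N'.card = A.card + N.card + 1
  exists_right : ∃ m, N' ⊆ insert m N

theorem Move.card_left {A N A' N' : Edges} (h : Move A N A' N') : A.card ≤ A'.card :=
  Finset.card_le_card h.left

theorem Move.unique {A N A' N' : Edges} (h : Move A N A' N') {e f : Sym2 Vtx} (he : e ∈ N')
    (hf : f ∈ N') (he' : e ∉ N) (hf' : f ∉ N) : e = f := by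
  obtain ⟨m, hm⟩ := h.exists_right
  grind

theorem St.legal_right {i : Bool} {A N R : Edges} (h : St i A N R) : ∀ e ∈ N, Legal e :=
  fun e he => (h.right e he).1

theorem St.notMem_red {i : Bool} {A N R : Edges} (h : St i A N R) : ∀ e ∈ N, e ∉ R :=
  fun e he hR => (h.disj e hR).2 he

/-- With at most seven blue edges, blue has at most eight after his next move and cannot have a
book, so red need not look at threats yet. -/
theorem reply_play {i : Bool} {A N R : Edges} {a b : Vtx} (hst : St i A N R) (hab : a ≠ b)
    (ha : a.side = !i) (hb : b.side = !i) (hN : e(a, b) ∉ N) (hR : e(a, b) ∉ R)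
    (hcard : A.card + N.card ≤ 7)
    (H : ∀ A' N', Move A N A' N' → St i A' N' (insert e(a, b) R) →
      Reply (A' ∪ N') (insert e(a, b) R)) : Reply (A ∪ N) R := by
  obtain ⟨hleft, hright, hred, hdisj⟩ := hst
  have hleg : Legal e(a, b) := legal_mk.2 ⟨hab, by grind⟩
  have hbd : InBoard (!i) e(a, b) := inBoard_mk.2 ⟨hab, ha, hb⟩
  have hA : e(a, b) ∉ A := fun h => (hleft _ h).not_not hbd
  refine ⟨e(a, b), hleg, by grind, hR, Or.inr (surv_of_reply fun f hf hfE hfR => ?_)⟩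
  have hfA : f ∉ A := by grind
  have hfN : f ∉ N := by grind
  refine ⟨fun hbk => ?_, ?_⟩
  · have h1 := hbk.le_card
    have h2 := Finset.card_insert_le f (A ∪ N)
    have h3 := Finset.card_union_le A N
    omega
  rcases hf.inBoard i with hfi | hfi
  · have hins : insert f (A ∪ N) = insert f A ∪ N := by grind
    rw [hins]
    refine H _ _ ⟨Finset.subset_insert _ _, subset_rfl, ?_, f, Finset.subset_insert _ _⟩
      ⟨by grind, hright, by grind, ?_⟩
    · rw [Finset.card_insert_of_notMem hfA]
      omega
    · grind
  · have hins : insert f (A ∪ N) = A ∪ insert f N := by grind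
    rw [hins]
    refine H _ _ ⟨subset_rfl, Finset.subset_insert _ _, ?_, f, subset_rfl⟩
      ⟨hleft, by grind, by grind, ?_⟩
    · rw [Finset.card_insert_of_notMem hfN]
      omega
    · grind

theorem reply_play_fresh {i : Bool} {A N R : Edges} {u : Vtx} (S : Finset Vtx)
    (hst : St i A N R) (hu : u.side = !i) (hcard : A.card + N.card ≤ 7)
    (H : ∀ t, t.side = (!i) → t ∉ S → t ≠ u → (∀ e ∈ N, t ∉ e) → (∀ e ∈ R, t ∉ e) →
      ∀ A' N', Move A N A' N' → St i A' N' (insert e(u, t) R) →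
      Reply (A' ∪ N') (insert e(u, t) R)) : Reply (A ∪ N) R := by
  obtain ⟨t, ht, htS, htE⟩ := exists_untouched (!i) (insert u S) (N ∪ R)
  have h1 : ∀ e ∈ N, t ∉ e := fun e he => htE e (Finset.mem_union_left _ he)
  have h2 : ∀ e ∈ R, t ∉ e := fun e he => htE e (Finset.mem_union_right _ he)
  rw [Finset.mem_insert, not_or] at htS
  exact reply_play hst (Ne.symm htS.1) hu ht (fun h => h1 _ h (right_mem_edge _ _))
    (fun h => h2 _ h (right_mem_edge _ _)) hcard (H t ht htS.2 htS.1 h1 h2)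

/-- The edge `s t` turns the triangle `u s s'` and the edge `u t` into two pages `s'`, `t` on the
spine `u s`. -/
theorem reply_play_diamond {i : Bool} {A N R : Edges} {u s s' t : Vtx} (hst : St i A N R)
    (hu : u.side = !i) (hus : e(u, s) ∈ R) (hus' : e(u, s') ∈ R) (hss' : e(s, s') ∈ R)
    (hut : e(u, t) ∈ R) (hN : e(s, t) ∉ N) (hR : e(s, t) ∉ R) (hsne : s ≠ t)
    (hcard : A.card + N.card ≤ 7)
    (H : ∀ A' N', Move A N A' N' → St i A' N' (insert e(s, t) R) → A'.card ≤ 6 ∧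
      Few N' (insert e(s, t) R) ∧ (Safe N' (insert e(s, t) R) u ∨ Safe N' (insert e(s, t) R) s)) :
    Reply (A ∪ N) R := by
  have h1 := legal_mk.1 (hst.red _ hus)
  have h2 := legal_mk.1 (hst.red _ hut)
  refine reply_play hst hsne (by grind) (by grind) hN hR hcard fun A' N' hm hst' => ?_
  obtain ⟨hA, hfew, hsafe⟩ := H A' N' hm hst'
  refine diamond_reply hst' hu hA (x₁ := s') (x₂ := t) ?_ (Finset.mem_insert_of_mem hus)
    (Finset.mem_insert_of_mem hus') (Finset.mem_insert_of_mem hss') (Finset.mem_insert_of_mem hut)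
    (Finset.mem_insert_self _ _) hfew hsafe
  rintro rfl
  exact hR hss'

theorem Move.card_right_le {A N A' N' : Edges} (h : Move A N A' N') : N'.card ≤ N.card + 1 := by
  have := h.card
  have := h.card_left
  omega

theorem Move.card_le_right {A N A' N' : Edges} (h : Move A N A' N') : N.card ≤ N'.card :=
  Finset.card_le_card h.right

theorem Move.card_left_le {A N A' N' : Edges} (h : Move A N A' N') : A'.card ≤ A.card + 1 := by
  have := h.card
  have := h.card_le_right
  omega

theorem Move.few {A N A' N' R : Edges} {e : Sym2 Vtx} (hm : Move A N A' N')
    (hfew : ∀ p q T, IsBook p q T → Disjoint (book p q T) R →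
      ∃ D ⊆ N, N.card ≤ D.card + 4 ∧ ∀ e ∈ D, e ∉ book p q T) : Few N' (insert e R) := by
  refine few_of_missing fun p q T hb hd => ?_
  obtain ⟨D, hD, hc, hDb⟩ := hfew p q T hb (hd.mono_right (Finset.subset_insert _ _))
  have := hm.card_right_le
  exact ⟨D, hD.trans hm.right, by omega, hDb⟩

/-- The bounds on blue edges are one lower than in `safe_or_of_mem` and `few_of_missing`, which
leaves room for blue's next move. -/
theorem reply_play_diamond_of_mem {i : Bool} {A N R : Edges} {u s s' t x : Vtx} (X : Edges)
    (hst : St i A N R) (hu : u.side = !i) (hus : e(u, s) ∈ R) (hus' : e(u, s') ∈ R)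
    (hss' : e(s, s') ∈ R) (hut : e(u, t) ∈ R) (hN : e(s, t) ∉ N) (hR : e(s, t) ∉ R) (hsne : s ≠ t)
    (hcard : A.card + N.card ≤ 7) (hA : A.card ≤ 5)
    (hfew : ∀ p q T, IsBook p q T → Disjoint (book p q T) R →
      ∃ D ⊆ N, N.card ≤ D.card + 4 ∧ ∀ e ∈ D, e ∉ book p q T)
    (hX : X ⊆ N) (hXu : ∀ e ∈ X, u ∉ e ∧ s ∉ e ∧ ∃ v ∈ e, e(u, v) ∈ R)
    (hXcard : N.card ≤ X.card + 4) (hsx : e(s, x) ∈ N) (hux : e(u, x) ∈ R)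
    (hx : ∀ v, e(x, v) ∈ X → e(s, v) ∈ R) : Reply (A ∪ N) R := by
  refine reply_play_diamond hst hu hus hus' hss' hut hN hR hsne hcard fun A' N' hm hst' =>
    ⟨by have := hm.card_left_le; omega, hm.few hfew, ?_⟩
  have hne := (legal_mk.1 (hst.red _ hus)).1
  have hxu := (legal_mk.1 (hst.red _ hux)).1.symm
  have := hm.card_right_le
  refine safe_or_of_mem hst'.legal_right hst'.notMem_red hne (Finset.mem_insert_of_mem hus)
    (hX.trans hm.right) (fun e he => ?_) (by omega) (hm.right hsx) (Finset.mem_insert_of_mem hux) hxu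
    fun v hv => Finset.mem_insert_of_mem (hx v hv)
  obtain ⟨h1, h2, v, hv, hv'⟩ := hXu e he
  exact ⟨h1, h2, v, hv, Finset.mem_insert_of_mem hv'⟩

theorem reply_play_diamond_of_card {i : Bool} {A N R : Edges} {u s s' t : Vtx} (X : Edges)
    (hst : St i A N R) (hu : u.side = !i) (hus : e(u, s) ∈ R) (hus' : e(u, s') ∈ R)
    (hss' : e(s, s') ∈ R) (hut : e(u, t) ∈ R) (hN : e(s, t) ∉ N) (hR : e(s, t) ∉ R) (hsne : s ≠ t)
    (hcard : A.card + N.card ≤ 7) (hA : A.card ≤ 5)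
    (hfew : ∀ p q T, IsBook p q T → Disjoint (book p q T) R →
      ∃ D ⊆ N, N.card ≤ D.card + 4 ∧ ∀ e ∈ D, e ∉ book p q T)
    (hX : X ⊆ N) (hXu : ∀ e ∈ X, u ∉ e ∧ s ∉ e ∧ ∃ v ∈ e, e(u, v) ∈ R)
    (hXcard : N.card ≤ X.card + 3) : Reply (A ∪ N) R := by
  refine reply_play_diamond hst hu hus hus' hss' hut hN hR hsne hcard fun A' N' hm hst' =>
    ⟨by have := hm.card_left_le; omega, hm.few hfew, ?_⟩
  have hne := (legal_mk.1 (hst.red _ hus)).1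
  have := hm.card_right_le
  refine safe_or_of_card hst'.legal_right hst'.notMem_red hne (Finset.mem_insert_of_mem hus)
    (hX.trans hm.right) (fun e he => ?_) (by omega)
  obtain ⟨h1, h2, v, hv, hv'⟩ := hXu e he
  exact ⟨h1, h2, v, hv, Finset.mem_insert_of_mem hv'⟩

theorem St.red_ne {i : Bool} {A N R : Edges} (h : St i A N R) {a b : Vtx} (hab : e(a, b) ∈ R) :
    a ≠ b := (legal_mk.1 (h.red _ hab)).1

theorem St.blue_ne {i : Bool} {A N R : Edges} (h : St i A N R) {a b : Vtx} (hab : e(a, b) ∈ N) :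
    a ≠ b := (legal_mk.1 (h.legal_right _ hab)).1

/-! ### The opening: reaching two red pages. -/

/-- The second player owns a triangle after three moves. -/
theorem triangle_reply {i : Bool} {A N R : Edges} {u y₁ y₂ : Vtx} (hst : St i A N R)
    (hu : u.side = !i) (h₁ : e(u, y₁) ∈ R) (h₂ : e(u, y₂) ∈ R) (h₁₂ : e(y₁, y₂) ∈ R)
    (hA : 1 ≤ A.card) (hcard : A.card + N.card = 4) : Reply (A ∪ N) R := by
  refine reply_play_fresh {y₁, y₂} hst hu (by omega) ?_
  intro t ht htS htu htN htR A' N' hm hst'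
  have hcA := hm.card_left
  have hc := hm.card
  have hc' := hm.card_left_le
  have u₁ := hst.red_ne h₁
  have u₂ := hst.red_ne h₂
  have n₁₂ := hst.red_ne h₁₂
  have ht₁ : y₁ ≠ t := by grind
  have ht₂ : y₂ ≠ t := by grind
  have hut : e(u, t) ∈ insert e(u, t) R := Finset.mem_insert_self _ _
  have h₂₁ : e(y₂, y₁) ∈ R := edge_comm y₁ y₂ ▸ h₁₂
  have hR : ∀ s, s ≠ t → s ≠ u → e(s, t) ∉ insert e(u, t) R := by
    intro s hs hsu h
    rcases Finset.mem_insert.1 h with h | h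
    · grind
    · exact htR _ h (right_mem_edge _ _)
  -- No blue edge meets `s` now, so at most one does after the next move, and every violation of
  -- safety at `s` needs two.
  have lonely : ∀ s s', s ≠ t → e(u, s) ∈ R → e(u, s') ∈ R → e(s, s') ∈ R →
      (∀ e ∈ N', s ∉ e) → Reply (A' ∪ N') (insert e(u, t) R) := by
    intro s s' hs hus hus' hss' hsN
    refine reply_play_diamond hst' hu (s := s) (s' := s') (Finset.mem_insert_of_mem hus)
      (Finset.mem_insert_of_mem hus') (Finset.mem_insert_of_mem hss') hut
      (fun h => hsN _ h (left_mem_edge _ _)) (hR s hs (hst.red_ne hus).symm) hs (by omega)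
      fun A'' N'' hm' hst'' => ⟨by have := hm'.card_left_le; omega,
        few_of_card (by have := hm'.card_right_le; omega), Or.inr ?_⟩
    have huniq : ∀ a b, e(s, a) ∈ N'' → e(s, b) ∈ N'' → a = b := by
      intro a b ha hb
      exact edge_injective s (hm'.unique ha hb (fun h => hsN _ h (left_mem_edge _ _))
        fun h => hsN _ h (left_mem_edge _ _))
    constructor
    · intro w t _ _ h1 h2 h3
      obtain rfl := huniq _ _ h1 h2
      exact hst''.blue_ne h3 rfl
    · intro w t t' _ _ hne h1 _ h3
      exact absurd (huniq _ _ h1 h3) hne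
  -- There are at most four blue edges, and one of them meets `s'` while missing `u` and `s`.
  have general : ∀ s s', s ≠ t → e(u, s) ∈ R → e(u, s') ∈ R → e(s, s') ∈ R →
      (∃ e ∈ N', s' ∈ e) → e(s, t) ∉ N' → Reply (A' ∪ N') (insert e(u, t) R) := by
    rintro s s' hs hus hus' hss' ⟨e, he, hs'e⟩ hst
    obtain ⟨j, rfl⟩ : ∃ j, e = e(s', j) := hs'e
    have hd := hst'.notMem_red _ he
    have n1 := hst'.red_ne (Finset.mem_insert_of_mem hus)
    have n2 := hst'.red_ne (Finset.mem_insert_of_mem hus')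
    have n3 := hst'.red_ne (Finset.mem_insert_of_mem hss')
    refine reply_play_diamond_of_card {e(s', j)} hst' hu (s := s) (s' := s')
      (Finset.mem_insert_of_mem hus) (Finset.mem_insert_of_mem hus')
      (Finset.mem_insert_of_mem hss') hut hst (hR s hs n1.symm) hs
      (by omega) (by omega) (fun _ _ _ _ _ => ⟨∅, by simp, by simp; omega, by simp⟩)
      (by simpa using he) ?_ ?_
    · intro e he
      rw [Finset.mem_singleton] at he
      subst he
      refine ⟨?_, ?_, s', left_mem_edge _ _, Finset.mem_insert_of_mem hus'⟩
      · clear * - hd n2 hus'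
        grind
      · clear * - hd n3 hss'
        grind
    · simp
      omega
  by_cases e₁ : ∀ e ∈ N', y₁ ∉ e
  · exact lonely y₁ y₂ ht₁ h₁ h₂ h₁₂ e₁
  by_cases e₂ : ∀ e ∈ N', y₂ ∉ e
  · exact lonely y₂ y₁ ht₂ h₂ h₁ h₂₁ e₂
  push Not at e₁ e₂
  by_cases h : e(y₁, t) ∈ N'
  · refine general y₂ y₁ ht₂ h₂ h₁ h₂₁ e₁ fun h' => ?_
    have := hm.unique h h' (fun h => htN _ h (right_mem_edge _ _))
      (fun h => htN _ h (right_mem_edge _ _))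
    grind
  · exact general y₁ y₂ ht₁ h₁ h₂ h₁₂ e₂ h

/-- The second player owns a triangle `u x y` and the edge `u x'`, the first player blocked with
`x' x` and `x' y`, and he has another edge which is of no use to him. -/
theorem blocked_reply {i : Bool} {A N R : Edges} {u x x' y : Vtx} (hst : St i A N R)
    (hu : u.side = !i) (hx : e(u, x) ∈ R) (hx' : e(u, x') ∈ R) (hy : e(u, y) ∈ R)
    (hxy : e(x, y) ∈ R) (bx : e(x', x) ∈ N) (by' : e(x', y) ∈ N)
    (hA : 1 ≤ A.card) (hcard : A.card + N.card = 5) (hwaste : 2 ≤ A.card ∨ ∃ c, e(u, c) ∈ N) :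
    Reply (A ∪ N) R := by
  refine reply_play_fresh {x, x', y} hst hu (by omega) ?_
  intro t ht htS htu htN htR A' N' hm hst'
  have hcA := hm.card_left
  have hc := hm.card
  have hcN := hm.card_right_le
  have hcN' := hm.card_le_right
  have ux := hst.red_ne hx
  have ux' := hst.red_ne hx'
  have uy := hst.red_ne hy
  have nxy := hst.red_ne hxy
  have nbx := hst.blue_ne bx
  have nby := hst.blue_ne by'
  have htx : x ≠ t := by grind
  have hty : y ≠ t := by grind
  have hut : e(u, t) ∈ insert e(u, t) R := Finset.mem_insert_self _ _
  have hN2 : 2 ≤ N.card := by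
    refine Finset.one_lt_card.2 ⟨_, bx, _, by', ?_⟩
    clear * - nxy nbx nby
    grind
  have hR : ∀ s, s ≠ t → s ≠ u → e(s, t) ∉ insert e(u, t) R := by
    intro s hs hsu h
    rcases Finset.mem_insert.1 h with h | h
    · grind
    · exact htR _ h (right_mem_edge _ _)
  have few : ∀ p q T, IsBook p q T → Disjoint (book p q T) (insert e(u, t) R) →
      ∃ D ⊆ N', N'.card ≤ D.card + 4 ∧ ∀ e ∈ D, e ∉ book p q T := by
    intro p q T hb hd
    rcases hwaste with hw | ⟨c, hc⟩
    · exact ⟨∅, by simp, by simp; omega, by simp⟩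
    -- If the book contains `u c`, then `u` is one of its vertices, and the red edges `u x'` and `u
    -- x` keep `x' x` out of it. So one of these two blue edges is always missed.
    · by_cases hcb : e(u, c) ∈ book p q T
      · refine ⟨{e(x', x)}, by simpa using hm.right bx, by simp; omega, ?_⟩
        intro e he
        rw [Finset.mem_singleton] at he
        subst he
        refine notMem_book_of_red hst'.red hd hcb hcb (left_mem_edge _ _) (left_mem_edge _ _) ?_ ?_
        · exact edge_comm u x' ▸ Finset.mem_insert_of_mem hx'
        · exact edge_comm u x ▸ Finset.mem_insert_of_mem hx
      · exact ⟨{e(u, c)}, by simpa using hm.right hc, by simp; omega, by simpa using hcb⟩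
  have general : ∀ s s', s ≠ t → e(u, s) ∈ R → e(u, s') ∈ R → e(s, s') ∈ R →
      e(x', s) ∈ N → e(x', s') ∈ N → e(s, t) ∉ N' → Reply (A' ∪ N') (insert e(u, t) R) := by
    intro s s' hs hus hus' hss' bs bs' hst''
    have n1 := hst.red_ne hus
    have n2 := hst.red_ne hus'
    have n3 := hst.red_ne hss'
    have n4 := hst.blue_ne bs
    refine reply_play_diamond_of_mem (x := x') {e(x', s')} hst' hu (s := s) (s' := s')
      (Finset.mem_insert_of_mem hus) (Finset.mem_insert_of_mem hus')
      (Finset.mem_insert_of_mem hss') hut hst'' (hR s hs n1.symm) hs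
      (by omega) (by omega) few (by simpa using hm.right bs') ?_ (by simp; omega)
      (edge_comm s x' ▸ hm.right bs) (Finset.mem_insert_of_mem hx') ?_
    · intro e he
      rw [Finset.mem_singleton] at he
      subst he
      refine ⟨?_, ?_, s', right_mem_edge _ _, Finset.mem_insert_of_mem hus'⟩
      · clear * - n2 ux'
        grind
      · clear * - n3 n4
        grind
    · intro v hv
      rw [Finset.mem_singleton] at hv
      rw [edge_injective _ hv]
      exact Finset.mem_insert_of_mem hss'
  by_cases h : e(x, t) ∈ N'
  · refine general y x hty hy hx (edge_comm x y ▸ hxy) by' bx fun h' => ?_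
    have := hm.unique h h' (fun h => htN _ h (right_mem_edge _ _))
      (fun h => htN _ h (right_mem_edge _ _))
    grind
  · exact general x y htx hx hy hxy bx by' h

/-- The second player owns a triangle `u x c` and the edge `u x'`, the first player owns the path
`x x' c d`, and books without red edges miss two of the first player's edges. -/
theorem path_fresh_reply {i : Bool} {A N R : Edges} {u x x' c d : Vtx} (hst : St i A N R)
    (hu : u.side = !i) (hx : e(u, x) ∈ R) (hx' : e(u, x') ∈ R) (hc : e(u, c) ∈ R)
    (hxc : e(x, c) ∈ R) (bx : e(x', x) ∈ N) (bc : e(x', c) ∈ N) (bd : e(c, d) ∈ N) (hd : d ≠ x')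
    (hA : 1 ≤ A.card) (hcard : A.card + N.card = 6) (hN : 4 ≤ N.card)
    (hfew : ∀ p q T, IsBook p q T → Disjoint (book p q T) R →
      ∃ D ⊆ N, 2 ≤ D.card ∧ ∀ e ∈ D, e ∉ book p q T) : Reply (A ∪ N) R := by
  refine reply_play_fresh {x, x', c} hst hu (by omega) ?_
  intro t ht htS htu htN htR A' N' hm hst'
  have hcA := hm.card_left
  have hcc := hm.card
  have hcN := hm.card_right_le
  have hcN' := hm.card_le_right
  have ux := hst.red_ne hx
  have ux' := hst.red_ne hx'
  have uc := hst.red_ne hc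
  have nxc := hst.red_ne hxc
  have nbx := hst.blue_ne bx
  have nbc := hst.blue_ne bc
  have htx : x ≠ t := by grind
  have htx' : x' ≠ t := by grind
  have htc : c ≠ t := by grind
  have hdu : d ≠ u := by
    rintro rfl
    exact hst.notMem_red _ bd (edge_comm d c ▸ hc)
  have hdx : d ≠ x := by
    rintro rfl
    exact hst.notMem_red _ bd (edge_comm d c ▸ hxc)
  have hut : e(u, t) ∈ insert e(u, t) R := Finset.mem_insert_self _ _
  have hR : ∀ s, s ≠ t → s ≠ u → e(s, t) ∉ insert e(u, t) R := by
    intro s hs hsu h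
    rcases Finset.mem_insert.1 h with h | h
    · grind
    · exact htR _ h (right_mem_edge _ _)
  have few : ∀ p q T, IsBook p q T → Disjoint (book p q T) (insert e(u, t) R) →
      ∃ D ⊆ N', N'.card ≤ D.card + 4 ∧ ∀ e ∈ D, e ∉ book p q T := by
    intro p q T hb hd
    obtain ⟨D, h1, h2, h3⟩ := hfew p q T hb (hd.mono_right (Finset.subset_insert _ _))
    exact ⟨D, h1.trans hm.right, by omega, h3⟩
  have mem : ∀ {e}, e ∈ R → e ∈ insert e(u, t) R := fun h => Finset.mem_insert_of_mem h
  -- If blue has blocked `x t`, the blocking edge itself is one of the two edges in `X` and the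
  -- spine is `u c`; otherwise `c d` takes that role and the spine is `u x`.
  by_cases h : e(x, t) ∈ N'
  · have h' : e(c, t) ∉ N' := fun h' => by
      have := hm.unique h h' (fun h => htN _ h (right_mem_edge _ _))
        (fun h => htN _ h (right_mem_edge _ _))
      grind
    refine reply_play_diamond_of_mem (x := x') {e(x', x), e(x, t)} hst' hu (s := c) (s' := x)
      (mem hc) (mem hx) (mem (edge_comm x c ▸ hxc)) hut h' (hR c htc uc.symm) htc (by omega)
      (by omega) few ?_ ?_ ?_ (edge_comm x' c ▸ hm.right bc) (mem hx') ?_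
    · rw [Finset.insert_subset_iff, Finset.singleton_subset_iff]
      exact ⟨hm.right bx, h⟩
    · intro e he
      rw [Finset.mem_insert, Finset.mem_singleton] at he
      rcases he with rfl | rfl
      · refine ⟨?_, ?_, x, right_mem_edge _ _, mem hx⟩
        · clear * - ux ux'; grind
        · clear * - nbc nxc; grind
      · refine ⟨?_, ?_, x, left_mem_edge _ _, mem hx⟩
        · clear * - ux htu; grind
        · clear * - htc nxc; grind
    · rw [Finset.card_pair (by clear * - nbx htx htx'; grind)]
      omega
    · intro v hv
      have : v = x := by
        rw [Finset.mem_insert, Finset.mem_singleton] at hv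
        clear * - hv nbx htx'
        grind
      subst this
      exact mem (edge_comm v c ▸ hxc)
  · refine reply_play_diamond_of_mem (x := x') {e(c, d), e(x', c)} hst' hu (s := x) (s' := c)
      (mem hx) (mem hc) (mem hxc) hut h (hR x htx ux.symm) htx (by omega)
      (by omega) few ?_ ?_ ?_ (edge_comm x' x ▸ hm.right bx) (mem hx') ?_
    · rw [Finset.insert_subset_iff, Finset.singleton_subset_iff]
      exact ⟨hm.right bd, hm.right bc⟩
    · intro e he
      rw [Finset.mem_insert, Finset.mem_singleton] at he
      rcases he with rfl | rfl
      · refine ⟨?_, ?_, c, left_mem_edge _ _, mem hc⟩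
        · clear * - uc hdu; grind
        · clear * - hdx nxc; grind
      · refine ⟨?_, ?_, c, right_mem_edge _ _, mem hc⟩
        · clear * - ux' uc; grind
        · clear * - nbx nxc; grind
    · rw [Finset.card_pair (by clear * - hd nbc; grind)]
      omega
    · intro v hv
      have : v = c := by
        rw [Finset.mem_insert, Finset.mem_singleton] at hv
        clear * - hv hd nbc
        grind
      subst this
      exact mem hxc

/-- The second player owns a triangle `u x c` and the edge `u x'`, the first player owns the path
`x x' c d`. -/
theorem path_reply {i : Bool} {A N R : Edges} {u x x' c d : Vtx} (hst : St i A N R)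
    (hu : u.side = !i) (hx : e(u, x) ∈ R) (hx' : e(u, x') ∈ R) (hc : e(u, c) ∈ R)
    (hxc : e(x, c) ∈ R) (bx : e(x', x) ∈ N) (bc : e(x', c) ∈ N) (bd : e(c, d) ∈ N) (hd : d ≠ x')
    (rud : e(u, d) ∉ R) (rxd : e(x, d) ∉ R) (rxd' : e(x', d) ∉ R)
    (hA : 1 ≤ A.card) (hcard : A.card + N.card = 5) : Reply (A ∪ N) R := by
  have ux := hst.red_ne hx
  have ux' := hst.red_ne hx'
  have uc := hst.red_ne hc
  have nxc := hst.red_ne hxc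
  have nbx := hst.blue_ne bx
  have nbc := hst.blue_ne bc
  have nbd := hst.blue_ne bd
  have hdu : d ≠ u := by
    rintro rfl
    exact hst.notMem_red _ bd (edge_comm d c ▸ hc)
  have hdx : d ≠ x := by
    rintro rfl
    exact hst.notMem_red _ bd (edge_comm d c ▸ hxc)
  have sux := legal_mk.1 (hst.red _ hx)
  have sux' := legal_mk.1 (hst.red _ hx')
  have suc := legal_mk.1 (hst.red _ hc)
  have scd := legal_mk.1 (hst.legal_right _ bd)
  have three : ({e(x', x), e(x', c), e(c, d)} : Edges).card = 3 := by
    refine Finset.card_eq_three.2 ⟨_, _, _, ?_, ?_, ?_, rfl⟩ <;>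
    · clear * - nxc nbx nbc nbd hdu hdx hd
      grind
  have hsub : ({e(x', x), e(x', c), e(c, d)} : Edges) ⊆ N := by
    simp only [Finset.insert_subset_iff, Finset.singleton_subset_iff]
    exact ⟨bx, bc, bd⟩
  have hN3 := Finset.card_le_card hsub
  -- If `x d` is blue, blue has the four-cycle `x x' c d` with red diagonal `x c`. Red takes the
  -- other diagonal `x' d`, so that a book without red edges misses an edge of each opposite pair.
  -- Otherwise red takes `x d` himself.
  by_cases hblue : e(x, d) ∈ N
  · have four : ({e(x, d), e(x', x), e(x', c), e(c, d)} : Edges).card = 4 := by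
      rw [Finset.card_insert_of_notMem, three]
      clear * - nxc nbx nbc nbd hdu hdx hd
      grind
    have hsub4 : ({e(x, d), e(x', x), e(x', c), e(c, d)} : Edges) ⊆ N := by
      rw [Finset.insert_subset_iff]
      exact ⟨hblue, hsub⟩
    have hN4 := Finset.card_le_card hsub4
    have hNeq := Finset.eq_of_subset_of_card_le hsub4 (by omega)
    have hxd' : e(x', d) ∉ N := by
      rw [← hNeq]
      clear * - nxc nbx nbc nbd hdu hdx hd
      grind
    refine reply_play hst hd.symm (by grind) (by grind) hxd' rxd' (by omega) fun A' N' hm hst' => ?_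
    have hcA := hm.card_left
    have hcc := hm.card
    have hcN' := hm.card_le_right
    have mem : ∀ {e}, e ∈ R → e ∈ insert e(x', d) R := fun h => Finset.mem_insert_of_mem h
    have hmem : e(x', d) ∈ insert e(x', d) R := Finset.mem_insert_self _ _
    refine path_fresh_reply hst' hu (mem hx) (mem hx') (mem hc) (mem hxc) (hm.right bx)
      (hm.right bc) (hm.right bd) hd (by omega) (by omega) (by omega) ?_
    intro p q T hb hdj
    have opp₁ : e(x', x) ∉ book p q T ∨ e(c, d) ∉ book p q T := by
      by_contra! h
      exact notMem_book_of_red hst'.red hdj h.2 h.2 (right_mem_edge _ _) (left_mem_edge _ _)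
        hmem (mem hxc) h.1
    have opp₂ : e(x', c) ∉ book p q T ∨ e(x, d) ∉ book p q T := by
      by_contra! h
      exact notMem_book_of_red hst'.red hdj h.2 h.2 (right_mem_edge _ _) (left_mem_edge _ _)
        hmem (mem (edge_comm x c ▸ hxc)) h.1
    have pair : ∀ f g, f ∈ N → g ∈ N → f ≠ g → f ∉ book p q T → g ∉ book p q T →
        ∃ D ⊆ N', 2 ≤ D.card ∧ ∀ e ∈ D, e ∉ book p q T := by
      intro f g hf hg hne hf' hg'
      refine ⟨{f, g}, ?_, (Finset.card_pair hne).ge, by simp [hf', hg']⟩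
      rw [Finset.insert_subset_iff, Finset.singleton_subset_iff]
      exact ⟨hm.right hf, hm.right hg⟩
    rcases opp₁ with h1 | h1 <;> rcases opp₂ with h2 | h2 <;> refine pair _ _ ?_ ?_ ?_ h1 h2 <;>
      first
      | assumption
      | (clear * - nxc nbx nbc nbd hdu hdx hd; grind)
  · refine reply_play hst hdx.symm (by grind) (by grind) hblue rxd (by omega) fun A' N' hm hst' => ?_
    have hcA := hm.card_left
    have hcc := hm.card
    have hcN := hm.card_right_le
    have hcN' := hm.card_le_right
    have mem : ∀ {e}, e ∈ R → e ∈ insert e(x, d) R := fun h => Finset.mem_insert_of_mem h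
    have hmem : e(x, d) ∈ insert e(x, d) R := Finset.mem_insert_self _ _
    have opp : ∀ p q T, Disjoint (book p q T) (insert e(x, d) R) →
        e(x', x) ∉ book p q T ∨ e(c, d) ∉ book p q T := by
      intro p q T hdj
      by_contra! h
      exact notMem_book_of_red hst'.red hdj h.1 h.1 (right_mem_edge _ _) (right_mem_edge _ _)
        (mem (edge_comm x c ▸ hxc)) (edge_comm x d ▸ hmem) h.2
    -- Red now aims at `u d`, which gives the pages `c`, `d` on the spine `x u`. If blue blocks, a
    -- book without red edges either contains `u d` and misses `x' x` and `x' c`, or misses `u d`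
    -- and one of `x' x` and `c d`.
    by_cases hud : e(u, d) ∈ N'
    · have four : ({e(u, d), e(x', x), e(x', c), e(c, d)} : Edges).card = 4 := by
        rw [Finset.card_insert_of_notMem, three]
        clear * - ux ux' uc hdu hdx hd
        grind
      have hsub4 : ({e(u, d), e(x', x), e(x', c), e(c, d)} : Edges) ⊆ N' := by
        rw [Finset.insert_subset_iff]
        exact ⟨hud, hsub.trans hm.right⟩
      have hN4 := Finset.card_le_card hsub4
      refine path_fresh_reply hst' hu (mem hx) (mem hx') (mem hc) (mem hxc) (hm.right bx)
        (hm.right bc) (hm.right bd) hd (by omega) (by omega) (by omega) ?_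
      intro p q T hb hdj
      have pair : ∀ f g, f ∈ N' → g ∈ N' → f ≠ g → f ∉ book p q T → g ∉ book p q T →
          ∃ D ⊆ N', 2 ≤ D.card ∧ ∀ e ∈ D, e ∉ book p q T := by
        intro f g hf hg hne hf' hg'
        refine ⟨{f, g}, ?_, (Finset.card_pair hne).ge, by simp [hf', hg']⟩
        rw [Finset.insert_subset_iff, Finset.singleton_subset_iff]
        exact ⟨hf, hg⟩
      by_cases hudb : e(u, d) ∈ book p q T
      · have red : ∀ v, e(u, v) ∈ R → e(x', v) ∉ book p q T := by
          intro v hv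
          refine notMem_book_of_red hst'.red hdj hudb hudb (left_mem_edge _ _) (left_mem_edge _ _)
            ?_ ?_
          · exact edge_comm u x' ▸ mem hx'
          · exact edge_comm u v ▸ mem hv
        exact pair _ _ (hm.right bx) (hm.right bc) (by clear * - nxc nbx nbc; grind) (red x hx)
          (red c hc)
      · rcases opp p q T hdj with h | h
        · exact pair _ _ hud (hm.right bx) (by clear * - ux ux' hdu hdx hd; grind) hudb h
        · exact pair _ _ hud (hm.right bd) (by clear * - uc hdu; grind) hudb h
    · have hxu : e(x, u) ∈ insert e(x, d) R := edge_comm u x ▸ mem hx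
      have hcx : e(c, x) ∈ insert e(x, d) R := edge_comm x c ▸ mem hxc
      have hud' : e(u, d) ∉ insert e(x, d) R := by
        rw [Finset.mem_insert, not_or]
        refine ⟨?_, rud⟩
        clear * - ux hdu
        grind
      refine reply_play_diamond_of_card {e(x', c), e(c, d)} hst' (u := x) (s := u) (s' := c) (by grind)
        hxu (mem hxc) (mem hc) hmem hud hud' hdu.symm (by omega) (by omega) ?_ ?_ ?_ ?_
      · intro p q T hb hdj
        have : ∀ f ∈ N', f ∉ book p q T →
            ∃ D ⊆ N', N'.card ≤ D.card + 4 ∧ ∀ e ∈ D, e ∉ book p q T := by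
          intro f hf hf'
          refine ⟨{f}, by simpa using hf, ?_, by simpa using hf'⟩
          rw [Finset.card_singleton]
          omega
        exact (opp p q T hdj).elim (this _ (hm.right bx)) (this _ (hm.right bd))
      · rw [Finset.insert_subset_iff, Finset.singleton_subset_iff]
        exact ⟨hm.right bc, hm.right bd⟩
      · intro e he
        rw [Finset.mem_insert, Finset.mem_singleton] at he
        rcases he with rfl | rfl
        · refine ⟨?_, ?_, c, right_mem_edge _ _, mem hxc⟩
          · clear * - nbx nxc; grind
          · clear * - ux' uc; grind
        · refine ⟨?_, ?_, c, left_mem_edge _ _, mem hxc⟩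
          · clear * - hdx nxc; grind
          · clear * - uc hdu; grind
      · rw [Finset.card_pair (by clear * - hd nbc; grind)]
        omega

/-- The second player owns `u x₀` and `u x₁`, the first player owns `x₀ x₁`. -/
theorem cherry_reply {i : Bool} {A N R : Edges} {u x₀ x₁ x₂ : Vtx} (hst : St i A N R)
    (hu : u.side = !i) (h₀ : e(u, x₀) ∈ R) (h₁ : e(u, x₁) ∈ R) (b₀₁ : e(x₀, x₁) ∈ N)
    (hx₂ : x₂.side = !i) (hux₂ : u ≠ x₂) (h₀₂ : x₀ ≠ x₂) (h₁₂ : x₁ ≠ x₂)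
    (bu : e(u, x₂) ∉ N) (b₀ : e(x₀, x₂) ∉ N) (b₁ : e(x₁, x₂) ∉ N)
    (ru : e(u, x₂) ∉ R) (r₀ : e(x₀, x₂) ∉ R) (r₁ : e(x₁, x₂) ∉ R)
    (hA : 1 ≤ A.card) (hcard : A.card + N.card = 3)
    (hwaste : (2 ≤ A.card ∨ ∃ c, e(u, c) ∈ N) ∨ ∃ d, e(x₂, d) ∈ N ∧ d ≠ x₀ ∧ d ≠ x₁ ∧ d ≠ u ∧
      e(u, d) ∉ R ∧ e(x₀, d) ∉ R ∧ e(x₁, d) ∉ R) : Reply (A ∪ N) R := by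
  refine reply_play hst hux₂ hu hx₂ bu ru (by omega) fun A₁ N₁ hm₁ hst₁ => ?_
  have ux₀ := hst.red_ne h₀
  have ux₁ := hst.red_ne h₁
  have n₀₁ := hst.blue_ne b₀₁
  have cA₁ := hm₁.card_left
  have cc₁ := hm₁.card
  -- `x` is one of `x₀`, `x₁` for which blue has not blocked `x x₂`, and `x'` is the other. After `x
  -- x₂`, red aims at `x' x₂`, which gives two pages on the spine `u x₂`.
  have key : ∀ x x', e(u, x) ∈ R → e(u, x') ∈ R → e(x', x) ∈ N → x ≠ x₂ → x' ≠ x₂ →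
      e(x, x₂) ∉ N₁ → e(x, x₂) ∉ R → e(x', x₂) ∉ R →
      ((2 ≤ A.card ∨ ∃ c, e(u, c) ∈ N) ∨ ∃ d, e(x₂, d) ∈ N ∧ d ≠ x ∧ d ≠ x' ∧ d ≠ u ∧
        e(u, d) ∉ R ∧ e(x, d) ∉ R ∧ e(x', d) ∉ R) → Reply (A₁ ∪ N₁) (insert e(u, x₂) R) := by
    intro x x' hx hx' bx nx nx' bx₂ rx rx' hwaste
    have ux := hst.red_ne hx
    have ux' := hst.red_ne hx'
    have nbx := hst.blue_ne bx
    have sx := legal_mk.1 (hst.red _ hx)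
    have mem : ∀ {e}, e ∈ R → e ∈ insert e(u, x₂) R := fun h => Finset.mem_insert_of_mem h
    have hmem : e(u, x₂) ∈ insert e(u, x₂) R := Finset.mem_insert_self _ _
    refine reply_play hst₁ nx (by grind) hx₂ bx₂ ?_ (by omega) fun A₂ N₂ hm₂ hst₂ => ?_
    · rw [Finset.mem_insert, not_or]
      refine ⟨?_, rx⟩
      clear * - ux nx
      grind
    have cA₂ := hm₂.card_left
    have cc₂ := hm₂.card
    have bx' : e(x', x) ∈ N₂ := hm₂.right (hm₁.right bx)
    have hN₂ := Finset.card_pos.2 ⟨_, bx'⟩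
    have mem₂ : ∀ {e}, e ∈ R → e ∈ insert e(x, x₂) (insert e(u, x₂) R) :=
      fun h => Finset.mem_insert_of_mem (mem h)
    have hmem₂ : e(u, x₂) ∈ insert e(x, x₂) (insert e(u, x₂) R) := Finset.mem_insert_of_mem hmem
    have hmem₂' : e(x, x₂) ∈ insert e(x, x₂) (insert e(u, x₂) R) := Finset.mem_insert_self _ _
    have notMem₂ : ∀ {e}, e ∉ R → e ≠ e(u, x₂) → e ≠ e(x, x₂) →
        e ∉ insert e(x, x₂) (insert e(u, x₂) R) := by
      intro e h1 h2 h3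
      simp only [Finset.mem_insert, not_or]
      exact ⟨h3, h2, h1⟩
    -- A block gives blue the path `x x' x₂`. The surplus edge from `hwaste` is either useless to
    -- him or extends this path.
    by_cases hblock : e(x', x₂) ∈ N₂
    · rcases hwaste with hw | ⟨d, hd, hdx, hdx', hdu, r1, r2, r3⟩
      · refine blocked_reply hst₂ hu (mem₂ hx) (mem₂ hx') hmem₂ hmem₂' bx' hblock (by omega)
          (by omega) (hw.imp (fun h => by omega) fun ⟨c, hc⟩ => ⟨c, hm₂.right (hm₁.right hc)⟩)
      · have hdx₂ := (hst.blue_ne hd).symm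
        refine path_reply hst₂ hu (mem₂ hx) (mem₂ hx') hmem₂ hmem₂' bx' hblock
          (hm₂.right (hm₁.right hd)) hdx' ?_ ?_ ?_ (by omega) (by omega)
        · refine notMem₂ r1 ?_ ?_ <;> (clear * - hdx hdx' hdu hdx₂ ux nx hux₂; grind)
        · refine notMem₂ r2 ?_ ?_ <;> (clear * - hdx hdx' hdu hdx₂ ux nx hux₂; grind)
        · refine notMem₂ r3 ?_ ?_ <;> (clear * - hdx hdx' hdu hdx₂ ux ux' nx nx' nbx hux₂; grind)
    · refine reply_play_diamond_of_card (u := u) (s := x₂) (s' := x) (t := x') {e(x', x)} hst₂ hu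
        hmem₂ (mem₂ hx) (edge_comm x x₂ ▸ hmem₂') (mem₂ hx') (edge_comm x' x₂ ▸ hblock) ?_ nx'.symm
        (by omega) (by omega) (fun _ _ _ _ _ => ⟨∅, by simp, by simp; omega, by simp⟩)
        (by simpa using bx') ?_ (by simp; omega)
      · rw [edge_comm x₂ x']
        refine notMem₂ rx' ?_ ?_ <;> (clear * - ux' nx' nbx hux₂; grind)
      · intro e he
        rw [Finset.mem_singleton] at he
        subst he
        refine ⟨?_, ?_, x, right_mem_edge _ _, mem₂ hx⟩
        · clear * - ux ux'; grind
        · clear * - nx nx'; grind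
  by_cases h : e(x₀, x₂) ∈ N₁
  · refine key x₁ x₀ h₁ h₀ b₀₁ h₁₂ h₀₂ (fun h' => ?_) r₁ r₀ ?_
    · have := hm₁.unique h h' b₀ b₁
      clear * - this n₀₁ h₀₂
      grind
    · exact hwaste.imp_right fun ⟨d, a1, a2, a3, a4, a5, a6, a7⟩ => ⟨d, a1, a3, a2, a4, a5, a7, a6⟩
  · exact key x₀ x₁ h₀ h₁ (edge_comm x₀ x₁ ▸ b₀₁) h₀₂ h₁₂ h r₀ r₁ hwaste

/-- The second player owns the edge `u x₀`, and the first player has made two moves. -/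
theorem edge_reply {i : Bool} {A N : Edges} {u x₀ : Vtx} (hst : St i A N {e(u, x₀)})
    (hu : u.side = !i) (hA : 1 ≤ A.card) (hcard : A.card + N.card = 2)
    (htouch : ∀ e ∈ N, x₀ ∈ e → u ∈ e) : Reply (A ∪ N) {e(u, x₀)} := by
  have hux₀ := hst.red_ne (Finset.mem_singleton_self _)
  have sux₀ := legal_mk.1 (hst.red _ (Finset.mem_singleton_self _))
  refine reply_play_fresh {x₀} hst hu (by omega) ?_
  intro x₁ hx₁ hx₁S hx₁u hx₁N _ A' N' hm hst'
  have cA := hm.card_left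
  have cc := hm.card
  have cN := hm.card_le_right
  have n₀₁ : x₀ ≠ x₁ := by grind
  have h₀ : e(u, x₀) ∈ insert e(u, x₁) ({e(u, x₀)} : Edges) := by simp
  have h₁ : e(u, x₁) ∈ insert e(u, x₁) ({e(u, x₀)} : Edges) := by simp
  have notMem : ∀ {e}, e ≠ e(u, x₁) → e ≠ e(u, x₀) →
      e ∉ insert e(u, x₁) ({e(u, x₀)} : Edges) := by
    intro e h1 h2
    simp [h1, h2]
  by_cases hb : e(x₀, x₁) ∈ N'
  swap
  · refine reply_play hst' n₀₁ (by grind) hx₁ hb ?_ (by omega) fun A₁ N₁ hm₁ hst₁ => ?_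
    · refine notMem ?_ ?_ <;> (clear * - hux₀ hx₁u n₀₁; grind)
    have := hm₁.card_left
    have := hm₁.card
    exact triangle_reply hst₁ hu (Finset.mem_insert_of_mem h₀) (Finset.mem_insert_of_mem h₁)
      (Finset.mem_insert_self _ _) (by omega) (by omega)
  have hnew : e(x₀, x₁) ∉ N := fun h => hx₁N _ h (right_mem_edge _ _)
  have hN' : ∀ e ∈ N', e ∈ N ∨ e = e(x₀, x₁) := by
    intro e he
    by_cases h : e ∈ N
    · exact Or.inl h
    · exact Or.inr (hm.unique he hb h hnew)
  have fresh : (2 ≤ A'.card ∨ ∃ c, e(u, c) ∈ N') →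
      Reply (A' ∪ N') (insert e(u, x₁) {e(u, x₀)}) := by
    intro hw
    obtain ⟨x₂, hx₂, hx₂S, hx₂N⟩ := exists_untouched (!i) {u, x₀, x₁} N'
    have m₁ : u ≠ x₂ := by grind
    have m₂ : x₀ ≠ x₂ := by grind
    have m₃ : x₁ ≠ x₂ := by grind
    have hno : ∀ v, e(v, x₂) ∉ N' := fun v h => hx₂N _ h (right_mem_edge _ _)
    refine cherry_reply hst' hu h₀ h₁ hb hx₂ m₁ m₂ m₃ (hno _) (hno _) (hno _) ?_ ?_ ?_ (by omega)
      (by omega) (Or.inl hw)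
    all_goals refine notMem ?_ ?_ <;> (clear * - m₁ m₂ m₃ hux₀ hx₁u n₀₁; grind)
  by_cases hA2 : 2 ≤ A'.card
  · exact fresh (Or.inl hA2)
  have hcN : N.card = 1 := by omega
  obtain ⟨m, rfl⟩ := Finset.card_eq_one.1 hcN
  have hmN : m ∈ N' := hm.right (Finset.mem_singleton_self _)
  by_cases hum : u ∈ m
  · obtain ⟨c, rfl⟩ : ∃ c, m = e(u, c) := hum
    exact fresh (Or.inr ⟨c, hmN⟩)
  -- As `u x₀` is red, `htouch` in effect says that no edge of `N` meets `x₀`.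
  have hx₀m : x₀ ∉ m := fun h => hum (htouch m (Finset.mem_singleton_self _) h)
  have hx₁m : x₁ ∉ m := hx₁N m (Finset.mem_singleton_self _)
  have hm2 := hst'.right m hmN
  obtain ⟨c, d, rfl⟩ := exists_edge m
  rw [inBoard_mk] at hm2
  simp only [mem_edge, not_or] at hum hx₀m hx₁m
  have hno : ∀ v w, e(v, w) ≠ e(c, d) → e(v, w) ≠ e(x₀, x₁) → e(v, w) ∉ N' := by
    intro v w h1 h2 h3
    rcases hN' _ h3 with h | h
    · exact h1 (Finset.mem_singleton.1 h)
    · exact h2 h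
  -- The surplus blue edge `c d` misses `u`, `x₀` and `x₁`. Taking its end `c` as third vertex makes
  -- it extend the path that arises from blue's block.
  refine cherry_reply (x₂ := c) hst' hu h₀ h₁ hb hm2.2.1 hum.1 hx₀m.1 hx₁m.1 ?_ ?_ ?_ ?_ ?_ ?_
    (by omega) (by omega)
    (Or.inr ⟨d, hmN, Ne.symm hx₀m.2, Ne.symm hx₁m.2, Ne.symm hum.2, ?_, ?_, ?_⟩)
  iterate 3 refine hno _ _ ?_ ?_ <;> (clear * - hux₀ hx₁u n₀₁ hum hx₀m hx₁m hm2; grind)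
  all_goals refine notMem ?_ ?_ <;> (clear * - hux₀ hx₁u n₀₁ hum hx₀m hx₁m hm2; grind)

/-- The second player does not lose the game of books with four pages on two infinite complete
graphs. -/
theorem surv_empty : Surv ∅ ∅ := by
  refine surv_of_reply fun f hf _ _ => ?_
  obtain ⟨i, hi⟩ : ∃ i, InBoard i f := (hf.inBoard true).elim (fun h => ⟨_, h⟩) fun h => ⟨_, h⟩
  have heq : (insert f ∅ : Edges) = {f} ∪ ∅ := by simp
  rw [heq]
  refine ⟨fun hb => by have := hb.le_card; simp at this, ?_⟩
  have hst : St i {f} ∅ ∅ := ⟨by simpa using hi, by simp, by simp, by simp⟩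
  -- Red opens in the component that blue has not touched.
  obtain ⟨a, ha, -⟩ := exists_fresh (!i) ∅
  obtain ⟨b, hb, hba⟩ := exists_fresh (!i) {a}
  have hab : a ≠ b := by grind
  refine reply_play hst hab ha hb (by simp) (by simp) (by simp) fun A N hm hst' => ?_
  have cA := hm.card_left
  have cc := hm.card
  rw [Finset.card_singleton] at cA cc
  rw [insert_empty_eq] at hst' ⊢
  have hN : N.card ≤ 1 := by
    simp only [Finset.card_empty] at cc
    omega
  simp only [Finset.card_empty] at cc
  -- Blue has at most one edge in this component and it is not `a b`, so one end of `a b` is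
  -- untouched; that end becomes `x₀`.
  by_cases h : ∀ e ∈ N, b ∈ e → a ∈ e
  · exact edge_reply hst' ha cA (by omega) h
  · rw [edge_comm a b] at hst' ⊢
    refine edge_reply hst' hb cA (by omega) fun e he _ => ?_
    push Not at h
    obtain ⟨e', he', hb', -⟩ := h
    rwa [Finset.card_le_one.1 hN e he e' he']

/-! ### From survival to the failure of every strategy. -/

/-- The book with four pages: all edges on six vertices which meet a given pair of vertices. -/
def bookGraph : SimpleGraph (Bool ⊕ Fin 4) where
  Adj a b := a ≠ b ∧ (a.isLeft ∨ b.isLeft)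
  symm := ⟨fun _ _ h => ⟨h.1.symm, h.2.symm⟩⟩
  loopless := ⟨fun _ h => h.1 rfl⟩

theorem bookGraph_isContained_iff {E : Edges} :
    bookGraph.IsContained (SimpleGraph.fromEdgeSet (E : Set (Sym2 Vtx))) ↔ HasBook E := by
  constructor
  · rintro ⟨f⟩
    have hinj := f.injective
    have hadj : ∀ a b, a ≠ b → (a.isLeft ∨ b.isLeft) → e(f a, f b) ∈ E := by
      intro a b hne h
      have := f.toHom.map_adj (show bookGraph.Adj a b from ⟨hne, h⟩)
      rw [SimpleGraph.fromEdgeSet_adj] at this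
      exact this.1
    refine ⟨f (Sum.inl true), f (Sum.inl false), Finset.univ.image fun t => f (Sum.inr t),
      ⟨?_, ?_, ?_, ?_⟩, book_subset_iff.2 ⟨?_, ?_⟩⟩
    · exact fun h => by simpa using hinj h
    · intro h
      obtain ⟨t, -, ht⟩ := Finset.mem_image.1 h
      simpa using hinj ht
    · intro h
      obtain ⟨t, -, ht⟩ := Finset.mem_image.1 h
      simpa using hinj ht
    · exact (Finset.card_image_of_injective Finset.univ (hinj.comp Sum.inr_injective)).trans
        (Finset.card_fin 4)
    · exact hadj _ _ (by simp) (by simp)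
    · intro t ht
      obtain ⟨t, -, rfl⟩ := Finset.mem_image.1 ht
      exact ⟨hadj _ _ (by simp) (by simp), hadj _ _ (by simp) (by simp)⟩
  · rintro ⟨p, q, T, hb, hs⟩
    rw [book_subset_iff] at hs
    have h1 := hb.ne
    have h2 := hb.left_notMem
    have h3 := hb.right_notMem
    let t : Fin 4 ≃ T := (T.equivFinOfCardEq hb.card_pages).symm
    let f : Bool ⊕ Fin 4 → Vtx := Sum.elim (fun b => if b then p else q) fun j => (t j : Vtx)
    have hinj : Function.Injective f := by
      have ht : ∀ j, (t j : Vtx) ≠ p ∧ (t j : Vtx) ≠ q := fun j =>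
        ⟨fun h => h2 (h ▸ (t j).2), fun h => h3 (h ▸ (t j).2)⟩
      rintro (a | a) (b | b) h
      · cases a <;> cases b <;> simp_all [f]
      · have := ht b
        cases a <;> simp_all [f]
      · have := ht a
        cases b <;> simp_all [f]
      · exact congrArg Sum.inr (t.injective (Subtype.ext h))
    have hpage : ∀ (b : Bool) (j : Fin 4), e(f (Sum.inl b), f (Sum.inr j)) ∈ E := by
      intro b j
      have := hs.2 _ (t j).2
      cases b
      exacts [this.2, this.1]
    refine ⟨⟨⟨f, ?_⟩, hinj⟩⟩
    intro a b hab
    rw [SimpleGraph.fromEdgeSet_adj]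
    refine ⟨?_, fun h => hab.1 (hinj h)⟩
    change e(f a, f b) ∈ E
    obtain ⟨hne, hl⟩ := hab
    rcases a with a | a <;> rcases b with b | b
    · cases a <;> cases b
      · exact absurd rfl hne
      · rw [edge_comm]; exact hs.1
      · exact hs.1
      · exact absurd rfl hne
    · exact hpage a b
    · rw [edge_comm]; exact hpage b a
    · simp at hl

/-- A position with the first player to move, given by the list of all moves, in which the second
player does not lose. -/
structure Position where
  moves : List (Sym2 Vtx)
  first : Edges
  second : Edges
  mem_moves : ∀ e, e ∈ moves ↔ e ∈ first ∨ e ∈ second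
  good : Surv first second ∨ HasBook second

/-- Play continues after red has a book; from then on he takes arbitrary free edges. The last clause
says that blue never has a book before red does. -/
theorem Position.exists_next {σ : List (Sym2 Vtx) → Sym2 Vtx}
    (hσ : IsStrategy (V := Vtx) twoKomega σ) (s : Position) :
    ∃ (g : Sym2 Vtx) (s' : Position), Legal (σ s.moves) ∧ σ s.moves ∉ s.moves ∧ Legal g ∧
      g ∉ s.moves ++ [σ s.moves] ∧ s'.moves = s.moves ++ [σ s.moves] ++ [g] ∧
      s'.first = insert (σ s.moves) s.first ∧ s'.second = insert g s.second ∧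
      (HasBook s'.first → HasBook s.second) := by
  have hfresh : ∀ E : Edges, ∃ e, Legal e ∧ e ∉ E := by
    intro E
    obtain ⟨a, ha, -⟩ := exists_fresh true ∅
    obtain ⟨b, hb, hab, hbE⟩ := exists_untouched true {a} E
    refine ⟨e(a, b), legal_mk.2 ⟨?_, ha.trans hb.symm⟩, fun h => hbE _ h (right_mem_edge _ _)⟩
    rintro rfl
    simp at hab
  obtain ⟨e, he, heE⟩ := hfresh (s.first ∪ s.second)
  obtain ⟨h1, h2⟩ := hσ s.moves ⟨e, he, by rw [s.mem_moves]; simpa using heE⟩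
  have h2' := h2
  rw [s.mem_moves, not_or] at h2'
  have make : ∀ g, Legal g → g ∉ insert (σ s.moves) s.first → g ∉ s.second →
      (HasBook (insert (σ s.moves) s.first) → HasBook s.second) →
      (Surv (insert (σ s.moves) s.first) (insert g s.second) ∨ HasBook (insert g s.second)) →
      ∃ (g : Sym2 Vtx) (s' : Position), Legal (σ s.moves) ∧ σ s.moves ∉ s.moves ∧ Legal g ∧
        g ∉ s.moves ++ [σ s.moves] ∧ s'.moves = s.moves ++ [σ s.moves] ++ [g] ∧
        s'.first = insert (σ s.moves) s.first ∧ s'.second = insert g s.second ∧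
        (HasBook s'.first → HasBook s.second) := by
    intro g hg hg1 hg2 himp hgood
    refine ⟨g, ⟨s.moves ++ [σ s.moves] ++ [g], _, _, ?_, hgood⟩, h1, h2, hg, ?_, rfl, rfl, rfl, himp⟩
    · intro e
      simp only [List.mem_append, s.mem_moves, List.mem_singleton, Finset.mem_insert]
      tauto
    · simp only [List.mem_append, s.mem_moves, List.mem_singleton]
      rw [Finset.mem_insert] at hg1
      tauto
  rcases s.good with h | h
  · obtain ⟨hn, g, hg, hg1, hg2, hor⟩ := h.step h1 h2'.1 h2'.2
    exact make g hg hg1 hg2 (fun h => absurd h hn) hor.symm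
  · obtain ⟨g, hg, hgE⟩ := hfresh (insert (σ s.moves) s.first ∪ s.second)
    rw [Finset.mem_union, not_or] at hgE
    exact make g hg hgE.1 hgE.2 (fun _ => h) (Or.inr (h.mono (Finset.subset_insert _ _)))

theorem history_succ {V : Type*} {p : ℕ → Option (Sym2 V)} {n : ℕ} {e : Sym2 V}
    (h : p n = some e) : history p (n + 1) = history p n ++ [e] := by
  simp [history, List.range_succ, List.filterMap_append, h]

/-- Iterating `Position.exists_next` against `σ` gives an infinite play in which blue never owns a
book first. -/
theorem not_isFirstPlayerWin_bookGraph : ¬ IsFirstPlayerWin (V := Vtx) twoKomega bookGraph := by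
  rintro ⟨σ, hσ, hwin⟩
  choose g next hf hf' hg hg' hmoves hfirst hsecond hbook using Position.exists_next hσ
  let S : ℕ → Position := fun n => Nat.rec ⟨[], ∅, ∅, by simp, Or.inl surv_empty⟩
    (fun _ s => next s) n
  have hS : ∀ k, S (k + 1) = next (S k) := fun k => rfl
  let p : ℕ → Option (Sym2 Vtx) := fun n =>
    if n % 2 = 0 then some (σ (S (n / 2)).moves) else some (g (S (n / 2)))
  have hp0 : ∀ k, p (2 * k) = some (σ (S k).moves) := by
    intro k
    simp only [p]
    rw [if_pos (by omega), show 2 * k / 2 = k by omega]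
  have hp1 : ∀ k, p (2 * k + 1) = some (g (S k)) := by
    intro k
    simp only [p]
    rw [if_neg (by omega), show (2 * k + 1) / 2 = k by omega]
  have hhist : ∀ k, history p (2 * k) = (S k).moves := by
    intro k
    induction k with
    | zero => rfl
    | succ k ih =>
      rw [show 2 * (k + 1) = 2 * k + 1 + 1 by ring, history_succ (hp1 k), history_succ (hp0 k), ih,
        hS, hmoves]
  have hnew : ∀ n e, p n = some e → Legal e ∧ e ∉ history p n := by
    intro n e he
    rcases Nat.even_or_odd' n with ⟨k, rfl | rfl⟩
    · rw [hp0, Option.some_inj] at he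
      subst he
      rw [hhist]
      exact ⟨hf _, hf' _⟩
    · rw [hp1, Option.some_inj] at he
      subst he
      rw [history_succ (hp0 k), hhist]
      exact ⟨hg _, hg' _⟩
  have hplay : IsPlay (V := Vtx) twoKomega p := by
    refine ⟨fun n e he => (hnew n e he).1, fun n e he m hm hme => (hnew n e he).2 ?_, ?_⟩
    · exact List.mem_filterMap.2 ⟨m, List.mem_range.2 hm, hme⟩
    · intro n hn
      simp only [p] at hn
      split_ifs at hn
  have hfollow : FirstPlayerFollows σ p := by
    intro n hn e he
    obtain ⟨k, rfl⟩ := hn.exists_two_nsmul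
    rw [smul_eq_mul] at he ⊢
    rw [hp0, Option.some_inj] at he
    rw [hhist, he]
  have hE1 : ∀ k e, e ∈ (S k).first ↔ ∃ j < k, p (2 * j) = some e := by
    intro k e
    induction k with
    | zero => simp [S]
    | succ k ih =>
      rw [hS, hfirst, Finset.mem_insert, ih, Nat.exists_lt_succ_right, hp0, Option.some_inj, or_comm,
        @eq_comm _ e]
  have hE2 : ∀ k e, e ∈ (S k).second ↔ ∃ j < k, p (2 * j + 1) = some e := by
    intro k e
    induction k with
    | zero => simp [S]
    | succ k ih =>
      rw [hS, hsecond, Finset.mem_insert, ih, Nat.exists_lt_succ_right, hp1, Option.some_inj, or_comm,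
        @eq_comm _ e]
  have hmover1 : ∀ k, moverGraph p (2 * k) =
      SimpleGraph.fromEdgeSet ((S (k + 1)).first : Set (Sym2 Vtx)) := by
    intro k
    unfold moverGraph
    congr 1
    ext e
    refine Iff.trans ?_ (hE1 (k + 1) e).symm
    constructor
    · rintro ⟨j, hj, hj2, he⟩
      refine ⟨j / 2, by omega, ?_⟩
      rwa [show 2 * (j / 2) = j by omega]
    · rintro ⟨j, hj, he⟩
      exact ⟨2 * j, by omega, by omega, he⟩
  have hmover2 : ∀ k, moverGraph p (2 * k + 1) =
      SimpleGraph.fromEdgeSet ((S (k + 1)).second : Set (Sym2 Vtx)) := by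
    intro k
    unfold moverGraph
    congr 1
    ext e
    refine Iff.trans ?_ (hE2 (k + 1) e).symm
    constructor
    · rintro ⟨j, hj, hj2, he⟩
      refine ⟨j / 2, by omega, ?_⟩
      rwa [show 2 * (j / 2) + 1 = j by omega]
    · rintro ⟨j, hj, he⟩
      exact ⟨2 * j + 1, by omega, by omega, he⟩
  obtain ⟨n, hn, ⟨-, hcopy⟩, hfirst'⟩ := hwin p hplay hfollow
  obtain ⟨k, rfl⟩ := hn.exists_two_nsmul
  rw [smul_eq_mul] at hcopy hfirst'
  rw [hmover1, bookGraph_isContained_iff] at hcopy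
  have hb := hbook _ hcopy
  -- A blue book after move `2 * k` requires a red book after move `2 * k - 1`; for `k = 0` red has
  -- no edges yet.
  cases k with
  | zero =>
    have := hb.le_card
    simp at this
  | succ k =>
    refine hfirst' (2 * k + 1) (by omega) ⟨by simp [hp1], ?_⟩
    rw [hmover2, bookGraph_isContained_iff]
    exact hb

end RamseyGame

theorem mainTheorem5 :
    ¬ ((∀ (W : Type) [Finite W] (H : SimpleGraph W),
          RamseyGame.IsFirstPlayerWin RamseyGame.Komega H) ∧
        (∀ (W : Type) [Finite W] (H : SimpleGraph W),
          RamseyGame.IsFirstPlayerWin RamseyGame.Komega H →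
            RamseyGame.IsFirstPlayerWin RamseyGame.twoKomega H)) := by
  rintro ⟨h₁, h₂⟩
  exact RamseyGame.not_isFirstPlayerWin_bookGraph (h₂ _ RamseyGame.bookGraph (h₁ _ _))
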